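/- Let $f,g\in\mathbb{C}\{x,y\}$ be holomorphic germs $(\mathbb{C}^2,0)\to(\mathbb{C},0)$ with Newton--Puiseux factorisations $f=u\,y^{E_1}\prod_{i=1}^p(x-\alpha_i(y))$, $g=u'\,y^{E_2}\prod_{j=1}^q(x-\beta_j(y))$, where $u,u'$ are units and the $\alpha_i,\beta_j$ are fractional power series of positive order. Let $\lambda_1,\dots,\lambda_N$ denote all the $\alpha_i$ and $\beta_j$, and assume that they are pairwise distinct. Write $O$ for the order in $y$. A \emph{polar root} is a fractional power series $\gamma$ with $O(\gamma)>0$, $J(\gamma(y),y)=0$ and $f(\gamma(y),y)g(\gamma(y),y)\neq0$, where $J=f_yg_x-f_xg_y$; its multiplicity is its multiplicity as a Newton--Puiseux root of $J$ (the order of vanishing of $J(x,y)$ in $x$ at $x=\gamma(y)$). The tree of $(f,g)$ is built as follows. The ground bar has height $0$ and carries all the $\lambda_k$. The trunks growing on a bar $B$ of finite height $h=h(B)$ are the classes of the $\lambda_k$ carried by $B$ under the relation $O(\lambda_k-\lambda_j)>h$. On top of each trunk sits the bar carrying the roots in that trunk, whose height is the minimum of $O(\lambda_k-\lambda_j)$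 over all $\lambda_k,\lambda_j$ in the trunk. Only bars of finite height are considered. For such a bar $B$, $\lambda_B$ is any $\lambda_k$ carried by $B$ with all terms $y^e$, $e\ge h$, omitted ($\lambda_B=0$ for the ground bar). A fractional power series $\xi$ \emph{climbs over $B$ at $a\in\mathbb{C}$} if $\xi=\lambda_B+ay^{h}+(\text{terms of order}>h)$; a trunk \emph{grows at $c$} if its members climb over $B$ at $c$; and $\xi$ \emph{leaves the tree on $B$ at $a$} if it climbs over $B$ at $a$ and no trunk grows on $B$ at $a$. Let $z_1,\dots,z_l$ be the points at which trunks grow on $B$, let $p_k$ and $q_k$ be the numbers of $\alpha_i$ and of $\beta_j$ in the trunk at $z_k$, and let $\nu_F(B)$ be the order in $y$ of $F(\lambda_B(y)+zy^{h},y)$ for generic $z$ (so $\nu_f=E_1$, $\nu_g=E_2$ on the ground bar). Put $\Delta_B(z_k)=\nu_f(B)q_k-\nu_g(B)p_k$ and $\mathscr M_B(z)=\sum_{k=1}^l\frac{\Delta_B(z_k)}{z-z_k}$. The point $z_k$ is \emph{collinear} if $\Delta_B(z_k)=0$, and $B$ is \emph{non-collinear} if $\Delta_B(z_k)\ne0$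 for some $k$. A \emph{pure mero-zero} on $B$ is a zero of $\mathscr M_B$ which is not a collinear point, and $m_B(z)$ is the multiplicity of $z$ as a zero of $\mathscr M_B$. Suppose that $z$ is a pure mero-zero on a non-collinear bar $B$. Then there are exactly $m_B(z)$ polar roots, counted with multiplicity, which climb over $B$ at $z$, and all of them leave the tree on $B$ at $z$. -/

import Mathlib

noncomputable section

namespace PolarTree

/-! ### Germs, arcs, substitution

A holomorphic germ at the origin of `ℂ²` is identified with its Taylor series, an element of
`ℂ{x, y} ⊆ ℂ⟦x, y⟧`; the variable `0` is `x` and the variable `1` is `y`.  Fractional power series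
in `y` are Hahn series with rational exponents and complex coefficients. -/

/-- The power series `F(x, y)` converges in a neighbourhood of the origin. -/
def IsConvergent (F : MvPowerSeries (Fin 2) ℂ) : Prop :=
  ∃ r : ℝ, 0 < r ∧ Summable fun n : Fin 2 →₀ ℕ => ‖MvPowerSeries.coeff n F‖ * r ^ (n 0 + n 1)

/-- The coefficient of `x ^ i * y ^ j` in `F`. -/
def coeffXY (F : MvPowerSeries (Fin 2) ℂ) (i j : ℕ) : ℂ :=
  MvPowerSeries.coeff (Finsupp.single 0 i + Finsupp.single 1 j) F

/-- The Jacobian determinant `J = f_y g_x - f_x g_y`. -/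
def jac (f g : MvPowerSeries (Fin 2) ℂ) : MvPowerSeries (Fin 2) ℂ :=
  MvPowerSeries.pderiv ℂ 1 f * MvPowerSeries.pderiv ℂ 0 g -
    MvPowerSeries.pderiv ℂ 0 f * MvPowerSeries.pderiv ℂ 1 g

/-- The arcs `ξ(y)` with `O_y(ξ) > 0`: fractional power series, that is, series in `y ^ (1 / D)` for
some positive integer `D`, all of whose exponents are positive (the zero series included). -/
def IsArc (ξ : HahnSeries ℚ ℂ) : Prop :=
  0 < ξ.orderTop ∧ ∃ D : ℕ, 0 < D ∧ ∀ q ∈ ξ.support, ∃ n : ℕ, q = (n : ℚ) / (D : ℚ)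

/-- The substitution `F(ξ(y), y) = ∑ a_{ij} ξ(y) ^ i y ^ j`, for `ξ` of positive order. -/
def evalAt (F : MvPowerSeries (Fin 2) ℂ) (ξ : HahnSeries ℚ ℂ) : HahnSeries ℚ ℂ :=
  (HahnSeries.SummableFamily.smulFamily (fun n : ℕ × ℕ => coeffXY F n.1 n.2)
    ((HahnSeries.SummableFamily.powers ξ).mul
      (HahnSeries.SummableFamily.powers (HahnSeries.single (1 : ℚ) (1 : ℂ))))).hsum

/-- The Newton-Puiseux roots `x = ξ(y)`, `O_y(ξ) > 0`, of `F`. -/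
def rootSet (F : MvPowerSeries (Fin 2) ℂ) : Set (HahnSeries ℚ ℂ) :=
  {ξ | IsArc ξ ∧ evalAt F ξ = 0}

/-- The multiplicity of `ξ` as a Newton-Puiseux root of `F`: the order of vanishing of `F(x, y)`, as
a function of `x`, at `x = ξ(y)`.  It is the least `i` with `(∂ⁱF/∂xⁱ)(ξ(y), y) ≠ 0`, and `⊤` if
there is no such `i`. -/
def rootMult (F : MvPowerSeries (Fin 2) ℂ) (ξ : HahnSeries ℚ ℂ) : ℕ∞ :=
  ⨅ i ∈ {i : ℕ | evalAt ((MvPowerSeries.pderiv ℂ 0)^[i] F) ξ ≠ 0}, (i : ℕ∞)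

/-- Polar roots of `(f, g)`: Newton-Puiseux roots of the Jacobian, which are not roots of
`f * g`. -/
def IsPolarRoot (f g : MvPowerSeries (Fin 2) ℂ) (γ : HahnSeries ℚ ℂ) : Prop :=
  IsArc γ ∧ evalAt (jac f g) γ = 0 ∧ evalAt f γ * evalAt g γ ≠ 0

/-! ### The tree model -/

/-- The data of a bar of finite height: its height, and the roots of `f * g` bundled in the trunk on
top of which the bar is drawn. -/
structure Bar where
  height : ℚ
  roots : Set (HahnSeries ℚ ℂ)

/-- The trunks growing on `B`: the classes of the roots modulo `h⁺`, where `h` is the height. -/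
def Bar.IsTrunk (B : Bar) (T : Set (HahnSeries ℚ ℂ)) : Prop :=
  ∃ l ∈ B.roots, T = {l' ∈ B.roots | (B.height : WithTop ℚ) < (l - l').orderTop}

/-- The bars of finite height of the tree whose set of roots is `Λ`.  The ground bar has height `0`;
its only trunk, the main trunk, carries all the roots (all of them have positive order).  On top of
a trunk `T` sits the bar whose height is the least contact order of members of `T`, if that
is finite. -/
inductive IsBar (Λ : Set (HahnSeries ℚ ℂ)) : Bar → Prop
  | ground : IsBar Λ ⟨0, Λ⟩
  | post (B : Bar) (T : Set (HahnSeries ℚ ℂ)) (h : ℚ) (hB : IsBar Λ B) (hT : B.IsTrunk T)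
      (hh : IsLeast {o : WithTop ℚ | ∃ l ∈ T, ∃ l' ∈ T, o = (l - l').orderTop}
        (h : WithTop ℚ)) : IsBar Λ ⟨h, T⟩

open Classical in
/-- `λ_B`: a root in `B` with all terms `y ^ e`, `e ≥ h(B)`, omitted (the choice of the root does
not matter); it is `0` if there is no root. -/
def Bar.stem (B : Bar) : HahnSeries ℚ ℂ :=
  if hne : B.roots.Nonempty then HahnSeries.truncLT B.height hne.some else 0

/-- The arc `λ_B(y) + z y ^ h(B)`. -/
def Bar.point (B : Bar) (z : ℂ) : HahnSeries ℚ ℂ :=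
  B.stem + HahnSeries.single B.height z

/-- `ξ` climbs over `B` at `a`: `ξ(y) = λ_B(y) + a y ^ h(B) + ⋯`. -/
def Bar.ClimbsAt (B : Bar) (ξ : HahnSeries ℚ ℂ) (a : ℂ) : Prop :=
  (B.height : WithTop ℚ) < (ξ - B.point a).orderTop

/-- A trunk grows on `B` at `c`. -/
def Bar.HasTrunkAt (B : Bar) (c : ℂ) : Prop :=
  ∃ T, B.IsTrunk T ∧ ∃ l ∈ T, B.ClimbsAt l c

/-- `ξ` leaves the tree on `B` at `a`. -/
def Bar.LeavesAt (B : Bar) (ξ : HahnSeries ℚ ℂ) (a : ℂ) : Prop :=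
  B.ClimbsAt ξ a ∧ ¬ B.HasTrunkAt a

/-- The number of roots of `F` in the trunk of `B` which grows at `c` (`0` if there is none).  For
`F = f` and `F = g` these are the two entries of the bimultiplicity of `c`. -/
def Bar.trunkCount (B : Bar) (F : MvPowerSeries (Fin 2) ℂ) (c : ℂ) : ℕ :=
  {l ∈ B.roots | B.ClimbsAt l c ∧ l ∈ rootSet F}.ncard

open Classical in
/-- `ν_F(B)`: the order in `y` of `F(λ_B(y) + z y ^ h(B), y)` for generic `z`.  On the ground bar
(`h = 0`, `λ_B = 0`) this is the order in `y` of `F(z, y)`, `z` generic near `0`, that is, the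
largest power of `y` dividing `F`.  For positive height, generic means all but finitely
many `z ∈ ℂ`. -/
def Bar.nu (B : Bar) (F : MvPowerSeries (Fin 2) ℂ) : ℚ :=
  if B.height = 0 then ((sInf {j : ℕ | ∃ i : ℕ, coeffXY F i j ≠ 0} : ℕ) : ℚ)
  else if hex : ∃ v : ℚ, ∀ᶠ z : ℂ in Filter.cofinite,
      (evalAt F (B.point z)).orderTop = (v : WithTop ℚ) then hex.choose
  else 0

/-- The determinant `Δ_B(c) = ν_f(B) q - ν_g(B) p`, where `[p, q]` is the bimultiplicity
of `c` on `B`. -/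
def Bar.delta (B : Bar) (f g : MvPowerSeries (Fin 2) ℂ) (c : ℂ) : ℚ :=
  B.nu f * (B.trunkCount g c : ℚ) - B.nu g * (B.trunkCount f c : ℚ)

/-- Collinear points. -/
def Bar.collinearPoints (B : Bar) (f g : MvPowerSeries (Fin 2) ℂ) : Set ℂ :=
  {c | B.HasTrunkAt c ∧ B.delta f g c = 0}

/-- Non-collinear points. -/
def Bar.nonCollinearPoints (B : Bar) (f g : MvPowerSeries (Fin 2) ℂ) : Set ℂ :=
  {c | B.HasTrunkAt c ∧ B.delta f g c ≠ 0}

/-- A bar is non-collinear if some trunk on it grows at a non-collinear point. -/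
def Bar.IsNonCollinear (B : Bar) (f g : MvPowerSeries (Fin 2) ℂ) : Prop :=
  (B.nonCollinearPoints f g).Nonempty

/-- The rational function `M_B(z) = ∑ Δ_B(c) / (z - c)` associated to `B`, the sum over the points
`c` at which trunks grow on `B`. -/
def Bar.mero (B : Bar) (f g : MvPowerSeries (Fin 2) ℂ) : RatFunc ℂ :=
  ∑ᶠ c ∈ {c : ℂ | B.HasTrunkAt c},
    RatFunc.C ((B.delta f g c : ℚ) : ℂ) / (RatFunc.X - RatFunc.C c)

/-- Zeros of `M_B` (a pole is not a zero, since numerator and denominator are coprime). -/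
def Bar.IsMeroZero (B : Bar) (f g : MvPowerSeries (Fin 2) ℂ) (z : ℂ) : Prop :=
  (B.mero f g).num.IsRoot z

/-- The multiplicity `m_B(z)` of `z` as a zero of `M_B`. -/
def Bar.meroMult (B : Bar) (f g : MvPowerSeries (Fin 2) ℂ) (z : ℂ) : ℕ :=
  (B.mero f g).num.rootMultiplicity z

/-- Pure mero-zeros: mero-zeros which are not collinear points. -/
def Bar.IsPureMeroZero (B : Bar) (f g : MvPowerSeries (Fin 2) ℂ) (z : ℂ) : Prop :=
  B.IsMeroZero f g z ∧ z ∉ B.collinearPoints f g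

/-- The set of polar roots which climb over `B` at `z`. -/
def polarRootsAt (f g : MvPowerSeries (Fin 2) ℂ) (B : Bar) (z : ℂ) : Set (HahnSeries ℚ ℂ) :=
  {γ | IsPolarRoot f g γ ∧ B.ClimbsAt γ z}

end PolarTree

end

noncomputable section

namespace PolarTree

open HahnSeries

/-! On a bar of height `h > 0`, consider the arcs `ξ = λ_B + z y^h + ⋯`. In the Newton-Puiseux
product of `f`, a factor `ξ - α` with `α` off the bar has a leading term independent of `z`, and one
with `α` on the bar at `c` has leading term `(z - c) y^h`. So `f(ξ, y)` leads with `κ ∏ (z - c)` in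
degree `μ = ν_f(B)`, and off the trunk points `f_x / f` leads with `S = ∑ 1 / (z - c)` in degree
`-h`; likewise for `g`, with `ν` and `T`.

With `θ = y d/dy`, the chain rule gives `y J = θ(f) g_x - f_x θ(g)` along `ξ`: the terms containing
`θ(ξ)` cancel. Since `θ` multiplies a leading coefficient by its exponent, `J(ξ, y)` leads with the
product of the leading coefficients of `f` and `g` times `μ T - ν S`, and `μ T - ν S` is `M_B(z)`
(`hasLead_jac`). Non-collinearity makes `M_B`, hence `J`, nonzero. Then `J` has its own
Newton-Puiseux product, whose leading coefficient is `κ_J ∏ (z - c)` over the contact points of the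
roots of `J`. The two expressions agree for all but finitely many `z`, hence as polynomials after
clearing denominators, and the multiplicity of `z` can be compared on both sides.

A pure mero-zero is not a trunk point: `M_B` has a genuine pole at each non-collinear one, and the
collinear ones are excluded. At such a `z` the leading coefficients of `f` and `g` do not vanish, so
the number of roots of `J` over `z` is `m_B(z)`; all of them are polar, and none follows a trunk. On
the ground bar every trunk grows at `0`, so `M_B = d / z` has no zero.

The algebra behind this is that substitution is a ring homomorphism obeying the chain rule (through
`addMonoidHom_eq_zero`), and that every nonzero formal series has a Puiseux factorisation
(`exists_puiseux_factorization`, by Weierstrass preparation and the Newton polygon). -/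

/-! ### Power series in `x` over power series in `y` -/

/-- `ℂ⟦x, y⟧` as the ring of power series in `x` over the ring of power series in `y`. -/
def xyEquiv : MvPowerSeries (Fin 2) ℂ ≃ₐ[ℂ] PowerSeries (PowerSeries ℂ) :=
  (MvPowerSeries.renameEquiv ℂ
    ((finSuccEquiv 1).trans (Equiv.optionCongr (Equiv.ofUnique (Fin 1) Unit)))).trans
    (MvPowerSeries.optionEquivLeft Unit ℂ)

lemma coeff_xyEquiv (F : MvPowerSeries (Fin 2) ℂ) (i j : ℕ) :
    PowerSeries.coeff j (PowerSeries.coeff i (xyEquiv F)) = coeffXY F i j := by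
  have h := MvPowerSeries.coeff_coeff_optionEquivLeft (σ := Unit) (R := ℂ)
    (MvPowerSeries.renameEquiv ℂ
      ((finSuccEquiv 1).trans (Equiv.optionCongr (Equiv.ofUnique (Fin 1) Unit))) F) i
      (Finsupp.single () j)
  refine h.trans ?_
  change MvPowerSeries.coeff _ (MvPowerSeries.rename _ F) = _
  have h2 := MvPowerSeries.coeff_embDomain_rename (R := ℂ)
    ((finSuccEquiv 1).trans (Equiv.optionCongr (Equiv.ofUnique (Fin 1) Unit))).toEmbedding F
    (Finsupp.single 0 i + Finsupp.single 1 j)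
  refine Eq.trans ?_ h2
  congr 1
  congr 1
  ext a
  rw [Finsupp.embDomain_eq_mapDomain, Finsupp.mapDomain_add, Finsupp.mapDomain_single,
    Finsupp.mapDomain_single]
  rcases a with _ | a
  · simp
  · have h : finSuccEquiv 1 1 = some 0 := finSuccEquiv_succ (0 : Fin 1)
    simp [h]

lemma xyEquiv_X0 : xyEquiv (MvPowerSeries.X 0) = PowerSeries.X := by
  simp [xyEquiv]

lemma xyEquiv_X1 : xyEquiv (MvPowerSeries.X 1) = PowerSeries.C PowerSeries.X := by
  have h : finSuccEquiv 1 1 = some 0 := finSuccEquiv_succ (0 : Fin 1)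
  simp [xyEquiv, h]
  rfl

lemma xyEquiv_C (c : ℂ) : xyEquiv (MvPowerSeries.C c) = PowerSeries.C (PowerSeries.C c) := by
  simp [xyEquiv]
  rfl

/-- One step of peeling off monomials; iterating it drives the order estimate in
`addMonoidHom_eq_zero`. -/
lemma exists_eq_C_add (F : MvPowerSeries (Fin 2) ℂ) : ∃ F₁ F₂,
    F = MvPowerSeries.C (MvPowerSeries.constantCoeff F) + MvPowerSeries.X 0 * F₁
      + MvPowerSeries.X 1 * F₂ := by
  obtain ⟨c, G, a, h⟩ : ∃ c G a, F = MvPowerSeries.C c + MvPowerSeries.X 0 * G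
      + MvPowerSeries.X 1 * a := by
    refine ⟨PowerSeries.constantCoeff (PowerSeries.constantCoeff (xyEquiv F)),
      xyEquiv.symm (PowerSeries.mk fun n => PowerSeries.coeff (n + 1) (xyEquiv F)),
      xyEquiv.symm (PowerSeries.C (PowerSeries.mk fun n =>
        PowerSeries.coeff (n + 1) (PowerSeries.constantCoeff (xyEquiv F)))), ?_⟩
    apply xyEquiv.injective
    simp only [map_add, map_mul, xyEquiv_C, xyEquiv_X0, xyEquiv_X1, AlgEquiv.apply_symm_apply]
    conv_lhs => rw [PowerSeries.eq_X_mul_shift_add_const (xyEquiv F)]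
    conv_lhs =>
      enter [2]
      rw [PowerSeries.eq_X_mul_shift_add_const (PowerSeries.constantCoeff (xyEquiv F))]
    simp only [map_add, map_mul]
    ring
  have hc : MvPowerSeries.constantCoeff F = c := by
    rw [h]; simp
  exact ⟨G, a, by rw [hc]; exact h⟩

lemma xyEquiv_pderiv (F : MvPowerSeries (Fin 2) ℂ) :
    xyEquiv (MvPowerSeries.pderiv ℂ 0 F) = PowerSeries.derivative _ (xyEquiv F) := by
  ext i j
  rw [coeff_xyEquiv, PowerSeries.coeff_derivative]
  have : ((i : PowerSeries ℂ) + 1) = PowerSeries.C ((i : ℂ) + 1) := by simp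
  rw [this, PowerSeries.coeff_mul_C, coeff_xyEquiv, coeffXY, MvPowerSeries.coeff_pderiv, coeffXY]
  simp [Finsupp.single_add, add_right_comm]

/-! ### Orders -/

/-- The exponents are archimedean, so multiples of a positive order outgrow any finite one. -/
lemma zero_of_orderTop {a s : HahnSeries ℚ ℂ} (hs : 0 < s.orderTop)
    (h : ∀ n : ℕ, n • s.orderTop ≤ a.orderTop) : a = 0 := by
  by_contra ha
  obtain ⟨q, hq⟩ := WithTop.ne_top_iff_exists.1 (orderTop_ne_top.2 ha)
  rcases eq_or_ne s.orderTop ⊤ with hs' | hs'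
  · have := h 1
    rw [hs', ← hq] at this
    simp at this
  obtain ⟨e, he⟩ := WithTop.ne_top_iff_exists.1 hs'
  rw [← he] at hs
  have he0 : 0 < e := by exact_mod_cast hs
  obtain ⟨n, hn⟩ := Archimedean.arch (q + 1) he0
  have := h n
  rw [← he, ← hq] at this
  have h3 : n • e ≤ q := by exact_mod_cast this
  linarith

/-- An additive map out of `ℂ⟦x, y⟧` that kills constants and is linear over the substitution
`x ↦ ξ`, `y ↦ η` vanishes. -/
lemma addMonoidHom_eq_zero {ξ η : HahnSeries ℚ ℂ} (hξ : 0 < ξ.orderTop) (hη : 0 < η.orderTop)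
    (δ : MvPowerSeries (Fin 2) ℂ →+ HahnSeries ℚ ℂ) (h0 : ∀ F, 0 ≤ (δ F).orderTop)
    (hC : ∀ c, δ (MvPowerSeries.C c) = 0) (hX : ∀ F, δ (MvPowerSeries.X 0 * F) = ξ * δ F)
    (hY : ∀ F, δ (MvPowerSeries.X 1 * F) = η * δ F) (F : MvPowerSeries (Fin 2) ℂ) : δ F = 0 := by
  -- Each peeling `F = c + x F₁ + y F₂` kills `c` and gains order at least `e`; below, `e` is the
  -- smaller of the two orders.
  have key : ∀ e : WithTop ℚ, e ≤ ξ.orderTop → e ≤ η.orderTop →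
      ∀ n : ℕ, ∀ F, n • e ≤ (δ F).orderTop := by
    intro e he1 he2 n
    induction n with
    | zero => simpa using h0
    | succ n ih =>
      intro F
      obtain ⟨F₁, F₂, hF⟩ := exists_eq_C_add F
      rw [hF, map_add, map_add, hC, hX, hY, zero_add]
      refine le_trans (le_min ?_ ?_) min_orderTop_le_orderTop_add
      · rw [orderTop_mul, succ_nsmul']
        exact add_le_add he1 (ih _)
      · rw [orderTop_mul, succ_nsmul']
        exact add_le_add he2 (ih _)
  rcases le_total ξ.orderTop η.orderTop with h | h
  · exact zero_of_orderTop hξ fun n => key _ le_rfl h n F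
  · exact zero_of_orderTop hη fun n => key _ h le_rfl n F

/-- The one variable version of `addMonoidHom_eq_zero`. -/
lemma addMonoidHom_eq_zero' {η : HahnSeries ℚ ℂ} (hη : 0 < η.orderTop)
    (δ : PowerSeries ℂ →+ HahnSeries ℚ ℂ) (h0 : ∀ F, 0 ≤ (δ F).orderTop)
    (hC : ∀ c, δ (PowerSeries.C c) = 0)
    (hY : ∀ F, δ (PowerSeries.X * F) = η * δ F) (F : PowerSeries ℂ) : δ F = 0 := by
  have key : ∀ n : ℕ, ∀ F, n • η.orderTop ≤ (δ F).orderTop := by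
    intro n
    induction n with
    | zero => simpa using h0
    | succ n ih =>
      intro F
      rw [PowerSeries.eq_X_mul_shift_add_const F, map_add, hC, hY, add_zero, orderTop_mul,
        succ_nsmul']
      exact add_le_add le_rfl (ih _)
  exact zero_of_orderTop hη fun n => key n F

/-! ### Substitution is a ring homomorphism -/

/-- The family of all monomials `ξ ^ i * y ^ j`. -/
def monomials (ξ : HahnSeries ℚ ℂ) : SummableFamily ℚ ℂ (ℕ × ℕ) :=
  (SummableFamily.powers ξ).mul (SummableFamily.powers (single (1 : ℚ) (1 : ℂ)))

/-- The series `y`. -/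
def yy : HahnSeries ℚ ℂ := single (1 : ℚ) (1 : ℂ)

lemma yy_pos : 0 < yy.orderTop := by
  rw [yy, orderTop_single one_ne_zero]; exact_mod_cast one_pos

lemma monomials_apply {ξ : HahnSeries ℚ ℂ} (hξ : 0 < ξ.orderTop) (n : ℕ × ℕ) :
    monomials ξ n = ξ ^ n.1 * yy ^ n.2 := by
  simp [monomials, SummableFamily.mul, hξ, yy]

lemma pow_orderTop_nonneg {ξ : HahnSeries ℚ ℂ} (hξ : 0 ≤ ξ.orderTop) (n : ℕ) :
    0 ≤ (ξ ^ n).orderTop :=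
  le_trans (nsmul_nonneg hξ n) (orderTop_nsmul_le_orderTop_pow ..)

lemma mul_orderTop_nonneg {a b : HahnSeries ℚ ℂ} (ha : 0 ≤ a.orderTop) (hb : 0 ≤ b.orderTop) :
    0 ≤ (a * b).orderTop := by
  rw [orderTop_mul]; exact add_nonneg ha hb

lemma evalAt_eq (F : MvPowerSeries (Fin 2) ℂ) (ξ : HahnSeries ℚ ℂ) :
    evalAt F ξ = (SummableFamily.smulFamily (fun n : ℕ × ℕ => coeffXY F n.1 n.2)
      (monomials ξ)).hsum := rfl

lemma evalAt_add (F G : MvPowerSeries (Fin 2) ℂ) (ξ : HahnSeries ℚ ℂ) :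
    evalAt (F + G) ξ = evalAt F ξ + evalAt G ξ := by
  rw [evalAt_eq, evalAt_eq, evalAt_eq, ← SummableFamily.hsum_add]
  congr 1
  ext n : 1
  simp [coeffXY, add_smul]

lemma evalAt_orderTop_nonneg (F : MvPowerSeries (Fin 2) ℂ) {ξ : HahnSeries ℚ ℂ}
    (hξ : 0 < ξ.orderTop) : 0 ≤ (evalAt F ξ).orderTop := by
  rw [le_orderTop_iff_forall]
  intro q hq
  rw [evalAt_eq, SummableFamily.hsum_smulFamily]
  refine finsum_eq_zero_of_forall_eq_zero fun n => ?_
  rw [monomials_apply hξ, coeff_eq_zero_of_lt_orderTop, smul_zero]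
  exact hq.trans_le (mul_orderTop_nonneg (pow_orderTop_nonneg hξ.le _)
    (pow_orderTop_nonneg yy_pos.le _))

lemma coeffXY_C (c : ℂ) (n : ℕ × ℕ) :
    coeffXY (MvPowerSeries.C c) n.1 n.2 = if n = 0 then c else 0 := by
  classical
  rw [coeffXY, MvPowerSeries.coeff_C]
  refine if_congr ?_ rfl rfl
  constructor
  · intro h
    have h0 := DFunLike.congr_fun h 0
    have h1 := DFunLike.congr_fun h 1
    simp at h0 h1
    exact Prod.ext h0 h1
  · rintro rfl
    simp

lemma evalAt_C (c : ℂ) {ξ : HahnSeries ℚ ℂ} (hξ : 0 < ξ.orderTop) :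
    evalAt (MvPowerSeries.C c) ξ = HahnSeries.C c := by
  ext q
  rw [evalAt_eq, SummableFamily.hsum_smulFamily, finsum_eq_single _ (0 : ℕ × ℕ)]
  · rw [coeffXY_C, monomials_apply hξ]
    simp [HahnSeries.coeff_one, HahnSeries.C_apply, HahnSeries.coeff_single]
  · intro n hn
    rw [coeffXY_C, if_neg hn, zero_smul]

lemma coeffXY_X0_mul_succ (F : MvPowerSeries (Fin 2) ℂ) (i j : ℕ) :
    coeffXY (MvPowerSeries.X 0 * F) (i + 1) j = coeffXY F i j := by
  rw [← coeff_xyEquiv, map_mul, xyEquiv_X0, PowerSeries.coeff_succ_X_mul, coeff_xyEquiv]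

lemma coeffXY_X0_mul_zero (F : MvPowerSeries (Fin 2) ℂ) (j : ℕ) :
    coeffXY (MvPowerSeries.X 0 * F) 0 j = 0 := by
  rw [← coeff_xyEquiv, map_mul, xyEquiv_X0, PowerSeries.coeff_zero_X_mul, map_zero]

lemma coeffXY_X1_mul_succ (F : MvPowerSeries (Fin 2) ℂ) (i j : ℕ) :
    coeffXY (MvPowerSeries.X 1 * F) i (j + 1) = coeffXY F i j := by
  rw [← coeff_xyEquiv, map_mul, xyEquiv_X1, PowerSeries.coeff_C_mul, PowerSeries.coeff_succ_X_mul,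
    coeff_xyEquiv]

lemma coeffXY_X1_mul_zero (F : MvPowerSeries (Fin 2) ℂ) (i : ℕ) :
    coeffXY (MvPowerSeries.X 1 * F) i 0 = 0 := by
  rw [← coeff_xyEquiv, map_mul, xyEquiv_X1, PowerSeries.coeff_C_mul, PowerSeries.coeff_zero_X_mul]

/-- Multiplying a series by a variable shifts its exponents by an injection `e` and its monomials by
the factor `s`, so the two sums differ by a reindexing. -/
lemma evalAt_shift (F G : MvPowerSeries (Fin 2) ℂ) {ξ : HahnSeries ℚ ℂ} (s : HahnSeries ℚ ℂ)
    (e : ℕ × ℕ ↪ ℕ × ℕ)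
    (h1 : ∀ n, coeffXY G (e n).1 (e n).2 = coeffXY F n.1 n.2)
    (h2 : ∀ n, monomials ξ (e n) = s * monomials ξ n)
    (h3 : ∀ n, n ∉ Set.range e → coeffXY G n.1 n.2 = 0) :
    evalAt G ξ = s * evalAt F ξ := by
  rw [evalAt_eq, evalAt_eq, ← SummableFamily.hsum_smul,
    ← SummableFamily.hsum_embDomain (s • SummableFamily.smulFamily _ _) e]
  congr 1
  ext n : 1
  by_cases hn : n ∈ Set.range e
  · obtain ⟨m, rfl⟩ := hn
    rw [SummableFamily.embDomain_image, SummableFamily.smul_apply, of_symm_smul_of_eq_mul]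
    simp only [SummableFamily.smulFamily_toFun, h1, h2]
    rw [← HahnSeries.C_mul_eq_smul, ← HahnSeries.C_mul_eq_smul]
    ring
  · rw [SummableFamily.embDomain_of_notMem_range _ _ hn]
    simp [h3 n hn]

lemma evalAt_X0_mul (F : MvPowerSeries (Fin 2) ℂ) {ξ : HahnSeries ℚ ℂ} (hξ : 0 < ξ.orderTop) :
    evalAt (MvPowerSeries.X 0 * F) ξ = ξ * evalAt F ξ := by
  refine evalAt_shift F _ ξ (e := (addRightEmbedding 1).prodMap (.refl ℕ)) ?_ ?_ ?_
  · intro n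
    exact coeffXY_X0_mul_succ F n.1 n.2
  · intro n
    rw [monomials_apply hξ, monomials_apply hξ]
    simp
    ring
  · rintro ⟨i, j⟩ h
    rcases i with _ | i
    · exact coeffXY_X0_mul_zero F j
    · exact absurd ⟨(i, j), rfl⟩ h

lemma evalAt_X1_mul (F : MvPowerSeries (Fin 2) ℂ) {ξ : HahnSeries ℚ ℂ} (hξ : 0 < ξ.orderTop) :
    evalAt (MvPowerSeries.X 1 * F) ξ = yy * evalAt F ξ := by
  refine evalAt_shift F _ yy (e := (Function.Embedding.refl ℕ).prodMap (addRightEmbedding 1)) ?_ ?_ ?_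
  · intro n
    exact coeffXY_X1_mul_succ F n.1 n.2
  · intro n
    rw [monomials_apply hξ, monomials_apply hξ]
    simp
    ring
  · rintro ⟨i, j⟩ h
    rcases j with _ | j
    · exact coeffXY_X1_mul_zero F i
    · exact absurd ⟨(i, j), rfl⟩ h

/-- `evalAt · ξ` as an additive map. -/
def evalAdd (ξ : HahnSeries ℚ ℂ) : MvPowerSeries (Fin 2) ℂ →+ HahnSeries ℚ ℂ :=
  AddMonoidHom.mk' (fun F => evalAt F ξ) fun F G => evalAt_add F G ξ

lemma evalAdd_apply (ξ : HahnSeries ℚ ℂ) (F : MvPowerSeries (Fin 2) ℂ) :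
    evalAdd ξ F = evalAt F ξ := rfl

lemma orderTop_sub_nonneg {a b : HahnSeries ℚ ℂ} (ha : 0 ≤ a.orderTop) (hb : 0 ≤ b.orderTop) :
    0 ≤ (a - b).orderTop :=
  le_trans (le_min ha hb) min_orderTop_le_orderTop_sub

lemma orderTop_add_nonneg {a b : HahnSeries ℚ ℂ} (ha : 0 ≤ a.orderTop) (hb : 0 ≤ b.orderTop) :
    0 ≤ (a + b).orderTop :=
  le_trans (le_min ha hb) min_orderTop_le_orderTop_add

/-- Checked coefficientwise, since this is the base case from which multiplicativity is deduced. -/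
lemma evalAt_C_mul (c : ℂ) (F : MvPowerSeries (Fin 2) ℂ) (ξ : HahnSeries ℚ ℂ) :
    evalAt (MvPowerSeries.C c * F) ξ = HahnSeries.C c * evalAt F ξ := by
  ext q
  rw [HahnSeries.C_mul_eq_smul, HahnSeries.coeff_smul, evalAt_eq, evalAt_eq,
    SummableFamily.hsum_smulFamily, SummableFamily.hsum_smulFamily, smul_finsum]
  refine finsum_congr fun n => ?_
  rw [coeffXY, MvPowerSeries.coeff_C_mul, smul_smul]
  rfl

/-- For fixed `G` the difference of the two sides is additive in `F`, kills constants and is linear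
over both variables, so `addMonoidHom_eq_zero` applies and no double sum has to be rearranged. -/
lemma evalAt_mul (F G : MvPowerSeries (Fin 2) ℂ) {ξ : HahnSeries ℚ ℂ} (hξ : 0 < ξ.orderTop) :
    evalAt (F * G) ξ = evalAt F ξ * evalAt G ξ := by
  have := addMonoidHom_eq_zero hξ yy_pos
    ((evalAdd ξ).comp (AddMonoidHom.mulRight G) -
      (AddMonoidHom.mulRight (evalAt G ξ)).comp (evalAdd ξ)) ?_ ?_ ?_ ?_ F
  · simpa [sub_eq_zero, evalAdd_apply] using this
  · intro F
    exact orderTop_sub_nonneg (evalAt_orderTop_nonneg _ hξ) (mul_orderTop_nonneg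
      (evalAt_orderTop_nonneg _ hξ) (evalAt_orderTop_nonneg _ hξ))
  · intro c
    simp [evalAdd_apply, evalAt_C_mul, evalAt_C c hξ]
  · intro F
    simp [evalAdd_apply, mul_assoc, evalAt_X0_mul _ hξ, mul_sub]
  · intro F
    simp [evalAdd_apply, mul_assoc, evalAt_X1_mul _ hξ, mul_sub]

/-- The substitution homomorphism `F ↦ F(ξ(y), y)`. -/
def evalHom {ξ : HahnSeries ℚ ℂ} (hξ : 0 < ξ.orderTop) :
    MvPowerSeries (Fin 2) ℂ →+* HahnSeries ℚ ℂ where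
  toFun F := evalAt F ξ
  map_zero' := (evalAdd ξ).map_zero
  map_one' := by simpa using evalAt_C 1 hξ
  map_add' F G := evalAt_add F G ξ
  map_mul' F G := evalAt_mul F G hξ

lemma evalHom_apply {ξ : HahnSeries ℚ ℂ} (hξ : 0 < ξ.orderTop) (F : MvPowerSeries (Fin 2) ℂ) :
    evalHom hξ F = evalAt F ξ := rfl

lemma evalAt_X0 {ξ : HahnSeries ℚ ℂ} (hξ : 0 < ξ.orderTop) :
    evalAt (MvPowerSeries.X 0) ξ = ξ := by
  have := evalAt_X0_mul 1 hξ
  rwa [mul_one, ← evalHom_apply hξ 1, map_one, mul_one] at this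

lemma evalAt_X1 {ξ : HahnSeries ℚ ℂ} (hξ : 0 < ξ.orderTop) :
    evalAt (MvPowerSeries.X 1) ξ = yy := by
  have := evalAt_X1_mul 1 hξ
  rwa [mul_one, ← evalHom_apply hξ 1, map_one, mul_one] at this

/-! ### The Euler derivation and the chain rule -/

/-- The derivation `y d/dy`. -/
def euler (a : HahnSeries ℚ ℂ) : HahnSeries ℚ ℂ where
  coeff q := (q : ℂ) * a.coeff q
  isPWO_support' := a.isPWO_support.mono fun q hq => by
    rw [Function.mem_support] at hq
    exact right_ne_zero_of_mul hq

lemma coeff_euler (a : HahnSeries ℚ ℂ) (q : ℚ) : (euler a).coeff q = (q : ℂ) * a.coeff q := rfl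

lemma support_euler_subset (a : HahnSeries ℚ ℂ) : (euler a).support ⊆ a.support := fun q hq => by
  rw [mem_support, coeff_euler] at hq
  exact right_ne_zero_of_mul hq

lemma orderTop_le_euler (a : HahnSeries ℚ ℂ) : a.orderTop ≤ (euler a).orderTop := by
  rw [le_orderTop_iff_forall]
  intro q hq
  rw [coeff_euler, coeff_eq_zero_of_lt_orderTop hq, mul_zero]

lemma euler_add (a b : HahnSeries ℚ ℂ) : euler (a + b) = euler a + euler b := by
  ext q; simp [coeff_euler, mul_add]

lemma euler_mul (a b : HahnSeries ℚ ℂ) : euler (a * b) = euler a * b + a * euler b := by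
  -- All three products are summed over pairs from the supports of `a` and `b`; `euler` may lose the
  -- exponent `0`, hence the inclusions of supports.
  ext q
  rw [coeff_add, coeff_euler, coeff_mul, coeff_mul_left' a.isPWO_support (support_euler_subset a),
    coeff_mul_right' b.isPWO_support (support_euler_subset b), Finset.mul_sum,
    ← Finset.sum_add_distrib]
  refine Finset.sum_congr rfl fun ij hij => ?_
  rw [Finset.mem_antidiagonal] at hij
  rw [coeff_euler, coeff_euler, ← hij.2.2]
  push_cast
  ring

lemma euler_single (q : ℚ) (c : ℂ) : euler (single q c) = single q ((q : ℂ) * c) := by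
  ext r
  rw [coeff_euler, coeff_single, coeff_single]
  split_ifs with h
  · rw [h]
  · rw [mul_zero]

/-- The chain rule for `y d/dy` of `F(ξ(y), y)`. -/
lemma euler_evalAt (F : MvPowerSeries (Fin 2) ℂ) {ξ : HahnSeries ℚ ℂ} (hξ : 0 < ξ.orderTop) :
    euler (evalAt F ξ) = evalAt (MvPowerSeries.pderiv ℂ 0 F) ξ * euler ξ +
      evalAt (MvPowerSeries.pderiv ℂ 1 F) ξ * yy := by
  have hθ : euler yy = yy := by rw [yy, euler_single]; simp
  let E : HahnSeries ℚ ℂ →+ HahnSeries ℚ ℂ := AddMonoidHom.mk' euler euler_add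
  have := addMonoidHom_eq_zero hξ yy_pos
    (E.comp (evalAdd ξ) -
      ((AddMonoidHom.mulRight (euler ξ)).comp
        ((evalAdd ξ).comp (MvPowerSeries.pderiv ℂ 0).toLinearMap.toAddMonoidHom) +
      (AddMonoidHom.mulRight yy).comp
        ((evalAdd ξ).comp (MvPowerSeries.pderiv ℂ 1).toLinearMap.toAddMonoidHom))) ?_ ?_ ?_ ?_ F
  · simpa [sub_eq_zero, evalAdd_apply, E] using this
  · intro F
    refine orderTop_sub_nonneg ((evalAt_orderTop_nonneg _ hξ).trans (orderTop_le_euler _))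
      (orderTop_add_nonneg
      (mul_orderTop_nonneg (evalAt_orderTop_nonneg _ hξ) (hξ.le.trans (orderTop_le_euler _)))
      (mul_orderTop_nonneg (evalAt_orderTop_nonneg _ hξ) yy_pos.le))
  · intro c
    simp [evalAdd_apply, E, evalAt_C c hξ, HahnSeries.C_apply, euler_single]
    rw [← evalHom_apply hξ, map_zero]
    simp
  · intro F
    have h10 : MvPowerSeries.pderiv ℂ (1 : Fin 2) (MvPowerSeries.X 0) = 0 :=
      MvPowerSeries.pderiv_X_of_ne (by decide)
    simp [evalAdd_apply, E, evalAt_X0_mul _ hξ, euler_mul,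
      evalAt_add, h10]
    ring
  · intro F
    have h01 : MvPowerSeries.pderiv ℂ (0 : Fin 2) (MvPowerSeries.X 1) = 0 :=
      MvPowerSeries.pderiv_X_of_ne (by decide)
    simp [evalAdd_apply, E, evalAt_X1_mul _ hξ, euler_mul,
      evalAt_add, h01, hθ]
    ring

/-! ### Fractional power series -/

/-- The substitution `t = y ^ (1 / D)`. -/
def ramify (D : ℕ) : PowerSeries ℂ →+* HahnSeries ℚ ℂ where
  toFun := PowerSeries.heval (single (1 / (D : ℚ)) (1 : ℂ))
  map_one' := map_one _
  map_mul' := map_mul _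
  map_zero' := map_zero _
  map_add' := map_add _

lemma coeff_ramify' {D : ℕ} (hD : 0 < D) (f : PowerSeries ℂ) (q : ℚ) :
    (ramify D f).coeff q = ∑ᶠ n : ℕ, PowerSeries.coeff n f * if q = n / D then 1 else 0 := by
  have hpos : 0 < (single (1 / (D : ℚ)) (1 : ℂ)).orderTop := by
    rw [orderTop_single one_ne_zero]
    exact_mod_cast one_div_pos.2 (Nat.cast_pos.2 hD)
  change (PowerSeries.heval _ f).coeff q = _
  rw [PowerSeries.coeff_heval]
  refine finsum_congr fun n => ?_
  simp only [SummableFamily.coeff_apply, SummableFamily.smulFamily_toFun, SummableFamily.powers_toFun,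
    hpos, if_true, single_pow, one_pow, HahnSeries.coeff_smul, smul_eq_mul, coeff_single]
  congr 2
  rw [nsmul_eq_mul, mul_one_div]

lemma coeff_ramify {D : ℕ} (hD : 0 < D) (f : PowerSeries ℂ) (n : ℕ) :
    (ramify D f).coeff (n / D) = PowerSeries.coeff n f := by
  rw [coeff_ramify' hD, finsum_eq_single _ n, if_pos rfl, mul_one]
  intro m hm
  rw [if_neg, mul_zero]
  have hD' : (D : ℚ) ≠ 0 := by positivity
  rw [div_left_inj' hD']
  exact_mod_cast hm.symm

lemma coeff_ramify_zero {D : ℕ} (hD : 0 < D) (f : PowerSeries ℂ) :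
    (ramify D f).coeff 0 = PowerSeries.constantCoeff f := by
  simpa using coeff_ramify hD f 0

lemma mem_range_ramify {D : ℕ} (hD : 0 < D) (a : HahnSeries ℚ ℂ) :
    a ∈ Set.range (ramify D) ↔ ∀ q ∈ a.support, ∃ n : ℕ, q = (n : ℚ) / (D : ℚ) := by
  constructor
  · rintro ⟨f, rfl⟩ q hq
    by_contra! h
    refine hq ?_
    rw [coeff_ramify' hD]
    exact finsum_eq_zero_of_forall_eq_zero fun n => by rw [if_neg (h n), mul_zero]
  · intro h
    refine ⟨PowerSeries.mk fun n => a.coeff (n / D), ?_⟩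
    ext q
    by_cases hq : ∃ n : ℕ, q = (n : ℚ) / (D : ℚ)
    · obtain ⟨n, rfl⟩ := hq
      rw [coeff_ramify hD, PowerSeries.coeff_mk]
    · have : a.coeff q = 0 := by
        by_contra h'
        exact hq (h q h')
      rw [this, coeff_ramify' hD]
      exact finsum_eq_zero_of_forall_eq_zero fun n => by
        rw [if_neg fun h' => hq ⟨n, h'⟩, mul_zero]

lemma ramify_range_mono {D E : ℕ} (hD : 0 < D) (hE : 0 < E) {a : HahnSeries ℚ ℂ}
    (ha : a ∈ Set.range (ramify D)) : a ∈ Set.range (ramify (D * E)) := by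
  rw [mem_range_ramify hD] at ha
  rw [mem_range_ramify (Nat.mul_pos hD hE)]
  intro q hq
  obtain ⟨n, rfl⟩ := ha q hq
  refine ⟨n * E, ?_⟩
  have hE' : (E : ℚ) ≠ 0 := by positivity
  push_cast
  rw [mul_div_mul_right _ _ hE']

/-- The ring of fractional power series of nonnegative order. -/
def puiseux : Subring (HahnSeries ℚ ℂ) where
  carrier := {a | ∃ D : ℕ, 0 < D ∧ a ∈ Set.range (ramify D)}
  zero_mem' := ⟨1, one_pos, 0, map_zero _⟩
  one_mem' := ⟨1, one_pos, 1, map_one _⟩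
  add_mem' := by
    rintro a b ⟨D, hD, ha⟩ ⟨E, hE, hb⟩
    obtain ⟨f, rfl⟩ := ramify_range_mono hD hE ha
    obtain ⟨g, rfl⟩ := mul_comm D E ▸ ramify_range_mono hE hD hb
    exact ⟨D * E, Nat.mul_pos hD hE, f + g, map_add _ _ _⟩
  mul_mem' := by
    rintro a b ⟨D, hD, ha⟩ ⟨E, hE, hb⟩
    obtain ⟨f, rfl⟩ := ramify_range_mono hD hE ha
    obtain ⟨g, rfl⟩ := mul_comm D E ▸ ramify_range_mono hE hD hb
    exact ⟨D * E, Nat.mul_pos hD hE, f * g, map_mul _ _ _⟩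
  neg_mem' := by
    rintro a ⟨D, hD, f, rfl⟩
    exact ⟨D, hD, -f, map_neg _ _⟩

lemma mem_puiseux {a : HahnSeries ℚ ℂ} :
    a ∈ puiseux ↔ ∃ D : ℕ, 0 < D ∧ a ∈ Set.range (ramify D) := Iff.rfl

lemma mem_puiseux_iff {a : HahnSeries ℚ ℂ} :
    a ∈ puiseux ↔ ∃ D : ℕ, 0 < D ∧ ∀ q ∈ a.support, ∃ n : ℕ, q = (n : ℚ) / (D : ℚ) := by
  rw [mem_puiseux]
  exact exists_congr fun D => and_congr_right fun hD => mem_range_ramify hD a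

lemma orderTop_nonneg_of_mem_puiseux {a : HahnSeries ℚ ℂ} (ha : a ∈ puiseux) : 0 ≤ a.orderTop := by
  obtain ⟨D, -, h⟩ := mem_puiseux_iff.1 ha
  rw [le_orderTop_iff_forall]
  intro q hq
  by_contra hc
  obtain ⟨n, rfl⟩ := h q hc
  have : ((n : ℚ) / D) < 0 := by exact_mod_cast hq
  exact absurd this (not_lt.2 (by positivity))

lemma isArc_iff {a : HahnSeries ℚ ℂ} : IsArc a ↔ 0 < a.orderTop ∧ a ∈ puiseux := by
  rw [IsArc, mem_puiseux_iff]

lemma exists_common_ramify {ι : Type*} (s : Finset ι) (a : ι → HahnSeries ℚ ℂ)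
    (h : ∀ i ∈ s, a i ∈ puiseux) : ∃ D : ℕ, 0 < D ∧ ∀ i ∈ s, a i ∈ Set.range (ramify D) := by
  classical
  induction s using Finset.induction_on with
  | empty => exact ⟨1, one_pos, by simp⟩
  | insert i s hi ih =>
    obtain ⟨D, hD, h1⟩ := ih fun j hj => h j (Finset.mem_insert_of_mem hj)
    obtain ⟨E, hE, h2⟩ := h i (Finset.mem_insert_self _ _)
    refine ⟨D * E, Nat.mul_pos hD hE, fun j hj => ?_⟩
    rcases Finset.mem_insert.1 hj with rfl | hj
    · exact mul_comm D E ▸ ramify_range_mono hE hD h2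
    · exact ramify_range_mono hD hE (h1 j hj)

lemma single_mem_puiseux {r : ℚ} (hr : 0 ≤ r) (c : ℂ) : single r c ∈ puiseux := by
  rw [mem_puiseux_iff]
  refine ⟨r.den, r.den_pos, fun q hq => ⟨r.num.toNat, ?_⟩⟩
  rw [support_single_subset hq]
  have : ((r.num.toNat : ℤ) : ℚ) = r.num := by
    rw [Int.toNat_of_nonneg (Rat.num_nonneg.2 hr)]
  rw [Int.cast_natCast] at this
  rw [this, Rat.num_div_den]

/-- Division by `y ^ r` keeps the denominators bounded, by `D * r.den`, and the order hypothesis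
keeps the exponents nonnegative. -/
lemma single_mul_mem_puiseux {a : HahnSeries ℚ ℂ} (ha : a ∈ puiseux) {r : ℚ}
    (h : (r : WithTop ℚ) ≤ a.orderTop) : single (-r) 1 * a ∈ puiseux := by
  obtain ⟨D, hD, h1⟩ := mem_puiseux_iff.1 ha
  refine mem_puiseux_iff.2 ⟨D * r.den, Nat.mul_pos hD r.den_pos, fun q hq => ?_⟩
  have hq' : a.coeff (q + r) ≠ 0 := by
    rw [mem_support] at hq
    have e : q = q + r + -r := by ring
    rwa [e, coeff_single_mul_add, one_mul] at hq
  obtain ⟨n, hn⟩ := h1 _ hq'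
  have hle : (r : WithTop ℚ) ≤ (q + r : ℚ) := h.trans (orderTop_le_of_coeff_ne_zero hq')
  have hq0 : 0 ≤ q := by
    have : r ≤ q + r := by exact_mod_cast hle
    linarith
  have hDQ : (D : ℚ) ≠ 0 := by positivity
  have hdQ : (r.den : ℚ) ≠ 0 := by exact_mod_cast r.den_nz
  have e : q * (D * r.den) = ((n * r.den - r.num * D : ℤ) : ℚ) := by
    have h2 : q = n / D - r := by linarith
    have h3 : (r.num : ℚ) = r * r.den := (Rat.mul_den_eq_num r).symm
    push_cast
    rw [h3, h2]
    field_simp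
  have hnn : 0 ≤ (n * r.den - r.num * D : ℤ) := by
    have : (0 : ℚ) ≤ ((n * r.den - r.num * D : ℤ) : ℚ) := by rw [← e]; positivity
    exact_mod_cast this
  refine ⟨(n * r.den - r.num * D : ℤ).toNat, ?_⟩
  have h4 : (((n * r.den - r.num * D : ℤ).toNat : ℤ) : ℚ) = ((n * r.den - r.num * D : ℤ) : ℚ) := by
    rw [Int.toNat_of_nonneg hnn]
  rw [Int.cast_natCast] at h4
  rw [h4, ← e]
  push_cast
  field_simp

/-! ### Hensel's lemma for power series -/

lemma residue_eq_zero {a : PowerSeries ℂ} :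
    IsLocalRing.residue (PowerSeries ℂ) a = 0 ↔ PowerSeries.constantCoeff a = 0 := by
  rw [IsLocalRing.residue_eq_zero_iff, PowerSeries.maximalIdeal_eq_span_X,
    Ideal.mem_span_singleton, PowerSeries.X_dvd_iff]

instance isAdicComplete_maximalIdeal :
    IsAdicComplete (IsLocalRing.maximalIdeal (PowerSeries ℂ)) (PowerSeries ℂ) := by
  rw [PowerSeries.maximalIdeal_eq_span_X]
  infer_instance

/-- Modulo `y`, `p` vanishes at `0` to an order between `1` and `j`. Weierstrass preparation
produces a monic factor of exactly that degree. -/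
lemma exists_factor (p : Polynomial (PowerSeries ℂ)) {j : ℕ}
    (h0 : PowerSeries.constantCoeff (p.coeff 0) = 0)
    (hj : PowerSeries.constantCoeff (p.coeff j) ≠ 0) :
    ∃ W Q : Polynomial (PowerSeries ℂ), p = W * Q ∧ W.Monic ∧ 0 < W.natDegree ∧
      W.natDegree ≤ j := by
  set g : PowerSeries (PowerSeries ℂ) := (p : PowerSeries (PowerSeries ℂ)) with hg
  have hgj : PowerSeries.coeff j (g.map (IsLocalRing.residue (PowerSeries ℂ))) ≠ 0 := by
    rw [PowerSeries.coeff_map, hg, Polynomial.coeff_coe, Ne, residue_eq_zero]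
    exact hj
  have hg0 : g.map (IsLocalRing.residue (PowerSeries ℂ)) ≠ 0 := by
    intro h
    rw [h] at hgj
    simp at hgj
  obtain ⟨W, h, H⟩ := PowerSeries.exists_isWeierstrassFactorization hg0
  have hdeg := H.natDegree_eq_toNat_order_map
  have hord : (g.map (IsLocalRing.residue (PowerSeries ℂ))).order ≤ j := PowerSeries.order_le j hgj
  have hord0 : (g.map (IsLocalRing.residue (PowerSeries ℂ))).order ≠ 0 := by
    rw [PowerSeries.order_ne_zero_iff_constCoeff_eq_zero,
      ← PowerSeries.coeff_zero_eq_constantCoeff_apply, PowerSeries.coeff_map, hg,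
      Polynomial.coeff_coe, residue_eq_zero]
    exact h0
  have hmonic : W.Monic := H.isDistinguishedAt.monic
  have hWdeg : W.degree = (((W : PowerSeries (PowerSeries ℂ)).map (Ideal.Quotient.mk
      (IsLocalRing.maximalIdeal (PowerSeries ℂ)))).order.toNat : ℕ) := by
    rw [Polynomial.degree_eq_natDegree hmonic.ne_zero]
    have h1 := H.isDistinguishedAt.coe_natDegree_eq_order_map (W : PowerSeries (PowerSeries ℂ)) 1
      (by rw [map_one, ← Ideal.ne_top_iff_one]; exact Ideal.IsPrime.ne_top') (by simp)
    rw [← h1, ENat.toNat_natCast]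
  -- Preparation only gives a power series cofactor. It and the Euclidean division of `p` by `W` are
  -- both Weierstrass divisions, so by uniqueness the Euclidean remainder is zero.
  have hmod : p %ₘ W = 0 := by
    refine (H.isDistinguishedAt.isWeierstrassDivisorAt'.eq_of_mul_add_eq_mul_add (r := p %ₘ W)
      (r' := 0) (q := (p /ₘ W : Polynomial (PowerSeries ℂ))) (q' := h) ?_ ?_ ?_).2
    · rw [← hWdeg]
      exact Polynomial.degree_modByMonic_lt _ hmonic
    · rw [← hWdeg, Polynomial.degree_zero, bot_lt_iff_ne_bot, Ne, Polynomial.degree_eq_bot]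
      exact hmonic.ne_zero
    · rw [Polynomial.coe_zero, add_zero, ← H.eq_mul, hg, ← Polynomial.coe_mul,
        ← Polynomial.coe_add, add_comm, Polynomial.modByMonic_add_div]
  refine ⟨W, p /ₘ W, ?_, hmonic, ?_, ?_⟩
  · conv_lhs => rw [← Polynomial.modByMonic_add_div p W, hmod, zero_add]
  · rw [hdeg]
    refine Nat.pos_of_ne_zero fun h => ?_
    rcases ENat.toNat_eq_zero.1 h with h | h
    · exact hord0 h
    · rw [h] at hord; simp at hord
  · rw [hdeg]
    exact ENat.toNat_le_of_le_natCast hord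

/-- Used twice: to remove the subleading coefficient by a translation, and to see that a polynomial
without one is a pure power `(X - c) ^ (n + 1)` only for `c = 0`. -/
lemma coeff_taylor_pred {R : Type*} [CommRing R] {p : Polynomial R} (hp : p.Monic) {n : ℕ}
    (hn : p.natDegree = n + 1) (r : R) :
    (Polynomial.taylor r p).coeff n = p.coeff n + (n + 1) * r := by
  have hdeg : (Polynomial.hasseDeriv n p).natDegree < 2 := by
    refine lt_of_le_of_lt (Polynomial.natDegree_hasseDeriv_le p n) ?_
    omega
  rw [Polynomial.taylor_coeff, Polynomial.eval_eq_sum_range' hdeg]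
  have h1 : p.coeff (n + 1) = 1 := by rw [← hn]; exact hp
  simp [Finset.sum_range_succ, Polynomial.hasseDeriv_coeff, add_comm 1 n, h1]

/-! ### The Newton-Puiseux theorem -/

/-- `ramify` with values in the ring of fractional power series. -/
def ramifyTo {D : ℕ} (hD : 0 < D) : PowerSeries ℂ →+* puiseux :=
  (ramify D).codRestrict puiseux fun f => ⟨D, hD, f, rfl⟩

lemma coe_ramifyTo {D : ℕ} (hD : 0 < D) (f : PowerSeries ℂ) :
    ((ramifyTo hD f : puiseux) : HahnSeries ℚ ℂ) = ramify D f := rfl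

/-- The step of the Newton-Puiseux algorithm after the coordinates have been rescaled. -/
lemma exists_root_of_coeff_ne_zero {n : ℕ}
    (ih : ∀ m ≤ n, 0 < m → ∀ p : Polynomial puiseux, p.Monic → p.natDegree = m → ∃ a, p.IsRoot a)
    (p : Polynomial puiseux) (hp : p.Monic) (hn : p.natDegree = n + 1) (h0 : p.coeff n = 0)
    {i : ℕ} (hin : i < n + 1) (hi : ((p.coeff i : puiseux) : HahnSeries ℚ ℂ).coeff 0 ≠ 0) :
    ∃ a, p.IsRoot a := by
  obtain ⟨D, hD, hlift⟩ := exists_common_ramify (Finset.range (n + 2))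
    (fun k => ((p.coeff k : puiseux) : HahnSeries ℚ ℂ)) fun k _ => (p.coeff k).2
  have hl : p ∈ Polynomial.lifts (ramifyTo hD) := by
    rw [Polynomial.lifts_iff_coeff_lifts]
    intro k
    rcases lt_or_ge k (n + 2) with hk | hk
    · obtain ⟨f, hf⟩ := hlift k (Finset.mem_range.2 hk)
      exact ⟨f, Subtype.ext hf⟩
    · exact ⟨0, by rw [map_zero, Polynomial.coeff_eq_zero_of_natDegree_lt (by omega)]⟩
  obtain ⟨P, hP, hPdeg, hPm⟩ := Polynomial.lifts_and_natDegree_eq_and_monic hl hp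
  rw [hn] at hPdeg
  have hcoeff : ∀ k, PowerSeries.constantCoeff (P.coeff k) =
      ((p.coeff k : puiseux) : HahnSeries ℚ ℂ).coeff 0 := by
    intro k
    rw [← hP, Polynomial.coeff_map, coe_ramifyTo, coeff_ramify_zero hD]
  set pb : Polynomial ℂ := P.map PowerSeries.constantCoeff with hpb
  have hpbm : pb.Monic := hPm.map _
  have hpbdeg : pb.natDegree = n + 1 := by rw [hpb, hPm.natDegree_map, hPdeg]
  have hpbn : pb.coeff n = 0 := by
    rw [hpb, Polynomial.coeff_map, hcoeff, h0]; rfl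
  have hpbi : pb.coeff i ≠ 0 := by
    rw [hpb, Polynomial.coeff_map, hcoeff]; exact hi
  obtain ⟨c, hc⟩ := Complex.exists_root (f := pb) (by
    rw [Polynomial.degree_eq_natDegree hpbm.ne_zero, hpbdeg]; exact_mod_cast Nat.succ_pos n)
  have htm : (Polynomial.taylor c pb).Monic := by
    rw [Polynomial.Monic, Polynomial.leadingCoeff_taylor]; exact hpbm
  -- Otherwise `pb = (X - c) ^ (n + 1)`; its subleading coefficient vanishes, so `c = 0`, against
  -- `pb.coeff i ≠ 0`. Hence the factor at `c` has degree at most `n` and the induction hypothesis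
  -- applies.
  have hj : ∃ j < n + 1, (Polynomial.taylor c pb).coeff j ≠ 0 := by
    by_contra! hcon
    have h1 := hcon n (Nat.lt_succ_self n)
    rw [coeff_taylor_pred hpbm hpbdeg, hpbn, zero_add, mul_eq_zero] at h1
    have hc0 : c = 0 := h1.resolve_left (by exact_mod_cast Nat.succ_ne_zero n)
    have h2 := hcon i hin
    rw [hc0, Polynomial.taylor_zero] at h2
    exact hpbi h2
  obtain ⟨j, hjn, hj⟩ := hj
  set P1 := Polynomial.taylor (PowerSeries.C c) P with hP1
  have hmap : ∀ k, PowerSeries.constantCoeff (P1.coeff k) = (Polynomial.taylor c pb).coeff k := by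
    intro k
    have : Polynomial.taylor c pb = P1.map PowerSeries.constantCoeff := by
      rw [hP1, hpb, Polynomial.taylor_apply, Polynomial.taylor_apply, Polynomial.map_comp]
      simp
    rw [this, Polynomial.coeff_map]
  obtain ⟨W, Q, hWQ, hWm, hW0, hWj⟩ := exists_factor P1 (j := j)
    (by rw [hmap, Polynomial.taylor_coeff_zero]; exact hc) (by rw [hmap]; exact hj)
  obtain ⟨a, ha⟩ := ih W.natDegree (by omega) hW0 (W.map (ramifyTo hD)) (hWm.map _)
    (hWm.natDegree_map _)
  refine ⟨a + ramifyTo hD (PowerSeries.C c), ?_⟩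
  have h3 : (P1.map (ramifyTo hD)).IsRoot a := by
    rw [hWQ, Polynomial.map_mul]
    exact Polynomial.root_mul_right_of_isRoot _ ha
  have h4 : P1.map (ramifyTo hD) = Polynomial.taylor (ramifyTo hD (PowerSeries.C c)) p := by
    rw [hP1, Polynomial.taylor_apply, Polynomial.taylor_apply, Polynomial.map_comp, hP]
    simp
  rw [h4, Polynomial.IsRoot, Polynomial.taylor_eval] at h3
  exact h3

/-- Newton polygon step: rescaling the roots by `y ^ (-r)`, with `r` the least slope, keeps all
coefficients integral and gives one below the top a nonzero constant term. -/
lemma exists_root_of_coeff_eq_zero {n : ℕ}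
    (ih : ∀ m ≤ n, 0 < m → ∀ p : Polynomial puiseux, p.Monic → p.natDegree = m → ∃ a, p.IsRoot a)
    (p : Polynomial puiseux) (hp : p.Monic) (hn : p.natDegree = n + 1) (h0 : p.coeff n = 0) :
    ∃ a, p.IsRoot a := by
  classical
  set S := (Finset.range (n + 1)).filter fun i => p.coeff i ≠ 0 with hS
  rcases S.eq_empty_or_nonempty with hSe | hSne
  · refine ⟨0, ?_⟩
    rw [Polynomial.IsRoot, ← Polynomial.coeff_zero_eq_eval_zero]
    by_contra h
    have : 0 ∈ S := by simp [hS, h]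
    rw [hSe] at this
    simp at this
  let v : ℕ → ℚ := fun i => ((p.coeff i : puiseux) : HahnSeries ℚ ℂ).order
  obtain ⟨i, hiS, himin⟩ := S.exists_min_image (fun i => v i / ((n + 1 - i : ℕ) : ℚ)) hSne
  obtain ⟨hin, hi0⟩ : i < n + 1 ∧ p.coeff i ≠ 0 := by simpa [hS] using hiS
  have hi0' : ((p.coeff i : puiseux) : HahnSeries ℚ ℂ) ≠ 0 := fun h => hi0 (Subtype.ext h)
  -- Rescaling divides the coefficient of degree `k` by `y ^ (r (n + 1 - k))`; minimality of `r`
  -- leaves its order nonnegative, and for `k = i` the order becomes `0`.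
  set r : ℚ := v i / ((n + 1 - i : ℕ) : ℚ) with hr
  have hpos : ∀ k < n + 1, (0 : ℚ) < ((n + 1 - k : ℕ) : ℚ) := fun k hk => by
    exact_mod_cast Nat.sub_pos_of_lt hk
  have hr0 : 0 ≤ r := by
    refine div_nonneg ?_ (hpos i hin).le
    have := orderTop_nonneg_of_mem_puiseux (p.coeff i).2
    rwa [zero_le_orderTop_iff] at this
  set q : Polynomial (HahnSeries ℚ ℂ) :=
    (p.map puiseux.subtype).scaleRoots (single (-r) 1) with hq
  have hpHdeg : (p.map puiseux.subtype).natDegree = n + 1 := by rw [hp.natDegree_map, hn]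
  have hqm : q.Monic := (Polynomial.monic_scaleRoots_iff _).2 (hp.map _)
  have hqdeg : q.natDegree = n + 1 := by rw [hq, Polynomial.natDegree_scaleRoots, hpHdeg]
  have hqcoeff : ∀ k, q.coeff k = single (-(r * ((n + 1 - k : ℕ) : ℚ))) 1 *
      ((p.coeff k : puiseux) : HahnSeries ℚ ℂ) := by
    intro k
    rw [hq, Polynomial.coeff_scaleRoots, hpHdeg, Polynomial.coeff_map, single_pow, one_pow, mul_comm,
      nsmul_eq_mul]
    congr 2
    ring_nf
  have hql : q ∈ Polynomial.lifts puiseux.subtype := by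
    rw [Polynomial.lifts_iff_coeff_lifts]
    intro k
    suffices h : q.coeff k ∈ puiseux from ⟨⟨_, h⟩, rfl⟩
    rw [hqcoeff]
    by_cases hk0 : p.coeff k = 0
    · rw [hk0]; simp
    refine single_mul_mem_puiseux (p.coeff k).2 ?_
    have hk0' : ((p.coeff k : puiseux) : HahnSeries ℚ ℂ) ≠ 0 := fun h => hk0 (Subtype.ext h)
    rw [← order_eq_orderTop_of_ne_zero hk0']
    refine WithTop.coe_le_coe.2 ?_
    rcases lt_or_ge k (n + 1) with hk | hk
    · have := himin k (by simp [hS, hk, hk0])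
      rwa [le_div_iff₀ (hpos k hk)] at this
    · rw [Nat.sub_eq_zero_of_le hk, Nat.cast_zero, mul_zero]
      have := orderTop_nonneg_of_mem_puiseux (p.coeff k).2
      rwa [zero_le_orderTop_iff] at this
  obtain ⟨Q, hQ, hQdeg, hQm⟩ := Polynomial.lifts_and_natDegree_eq_and_monic hql hqm
  have hQcoeff : ∀ k, ((Q.coeff k : puiseux) : HahnSeries ℚ ℂ) = q.coeff k := by
    intro k
    rw [← hQ, Polynomial.coeff_map]; rfl
  obtain ⟨a, ha⟩ := exists_root_of_coeff_ne_zero ih Q hQm (hQdeg.trans hqdeg)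
    (Subtype.ext (by rw [hQcoeff, hqcoeff, h0]; simp)) hin (by
      rw [hQcoeff, hqcoeff, hr, div_mul_cancel₀ _ (hpos i hin).ne']
      have h := coeff_single_mul_add (r := (1 : ℂ)) (x := ((p.coeff i : puiseux) : HahnSeries ℚ ℂ))
        (a := v i) (b := -v i)
      rw [add_neg_cancel, one_mul] at h
      rw [h]
      exact coeff_order_eq_zero.not.2 hi0')
  refine ⟨⟨single r 1, single_mem_puiseux hr0 1⟩ * a, ?_⟩
  have h1 : q.eval (a : HahnSeries ℚ ℂ) = 0 := by
    rw [← hQ]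
    have := congrArg puiseux.subtype ha
    rwa [← Polynomial.eval_map_apply, map_zero] at this
  have h2 : q.scaleRoots (single r 1) = p.map puiseux.subtype := by
    rw [hq, ← Polynomial.scaleRoots_mul, single_mul_single, neg_add_cancel, one_mul]
    exact Polynomial.scaleRoots_one _
  have h3 := Polynomial.scaleRoots_eval₂_eq_zero (p := q) (s := single r 1)
    (RingHom.id (HahnSeries ℚ ℂ)) h1
  rw [h2, RingHom.id_apply] at h3
  refine Subtype.ext ?_
  change puiseux.subtype (p.eval _) = 0
  rw [← Polynomial.eval_map_apply]
  exact h3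

/-- The ring of fractional power series has roots of monic polynomials. -/
theorem exists_root (n : ℕ) : 0 < n → ∀ p : Polynomial puiseux, p.Monic → p.natDegree = n →
    ∃ a, p.IsRoot a := by
  induction n using Nat.strong_induction_on with
  | _ n ih =>
    intro hn p hp hdeg
    obtain ⟨n, rfl⟩ : ∃ k, n = k + 1 := ⟨n - 1, by omega⟩
    -- `u` is the inverse of the degree; translating by `-u * p.coeff n` kills the subleading
    -- coefficient (Tschirnhaus).
    set u : puiseux := ⟨single 0 (1 / ((n : ℂ) + 1)), single_mem_puiseux le_rfl _⟩ with hu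
    have hun : ((n : puiseux) + 1) * u = 1 := by
      refine Subtype.ext ?_
      have h : ((n : HahnSeries ℚ ℂ) + 1) = single 0 ((n : ℂ) + 1) := by
        change _ = HahnSeries.C _
        rw [map_add, map_natCast, map_one]
      change ((n : HahnSeries ℚ ℂ) + 1) * single 0 (1 / ((n : ℂ) + 1)) = 1
      rw [h, single_mul_single, add_zero, mul_one_div_cancel (by exact_mod_cast Nat.succ_ne_zero n)]
      rfl
    obtain ⟨a, ha⟩ := exists_root_of_coeff_eq_zero (n := n)
      (fun m hm hm0 p hp hd => ih m (by omega) hm0 p hp hd)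
      (Polynomial.taylor (-(u * p.coeff n)) p)
      (by rw [Polynomial.Monic, Polynomial.leadingCoeff_taylor]; exact hp)
      (by rw [Polynomial.natDegree_taylor, hdeg])
      (by
        rw [coeff_taylor_pred hp hdeg]
        linear_combination (-p.coeff n) * hun)
    refine ⟨a + -(u * p.coeff n), ?_⟩
    rwa [Polynomial.IsRoot, Polynomial.taylor_eval] at ha

/-- **Newton-Puiseux theorem**: monic polynomials split over the fractional power series. -/
theorem exists_eq_prod_X_sub_C (n : ℕ) : ∀ p : Polynomial puiseux, p.Monic → p.natDegree = n →
    ∃ s : Multiset puiseux, p = (s.map fun a => Polynomial.X - Polynomial.C a).prod := by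
  induction n with
  | zero =>
    intro p hp hd
    exact ⟨0, by simpa using hp.natDegree_eq_zero.1 hd⟩
  | succ n ih =>
    intro p hp hd
    obtain ⟨a, ha⟩ := exists_root (n + 1) n.succ_pos p hp hd
    have hfac := Polynomial.mul_divByMonic_eq_iff_isRoot.2 ha
    have hm : (p /ₘ (Polynomial.X - Polynomial.C a)).Monic :=
      (Polynomial.monic_X_sub_C a).of_mul_monic_left (by rw [hfac]; exact hp)
    obtain ⟨s, hs⟩ := ih _ hm (by
      rw [Polynomial.natDegree_divByMonic _ (Polynomial.monic_X_sub_C a), hd,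
        Polynomial.natDegree_X_sub_C]; rfl)
    exact ⟨a ::ₘ s, by rw [Multiset.map_cons, Multiset.prod_cons, ← hs, hfac]⟩

/-! ### Substitution into Weierstrass polynomials -/

lemma coeff_zero_mul {a b : HahnSeries ℚ ℂ} (ha : 0 ≤ a.orderTop) (hb : 0 < b.orderTop) :
    (a * b).coeff 0 = 0 := by
  apply coeff_eq_zero_of_lt_orderTop
  rw [orderTop_mul]
  exact hb.trans_le (le_add_of_nonneg_left ha)

lemma coeff_zero_evalAt (F : MvPowerSeries (Fin 2) ℂ) {ξ : HahnSeries ℚ ℂ} (hξ : 0 < ξ.orderTop) :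
    (evalAt F ξ).coeff 0 = MvPowerSeries.constantCoeff F := by
  obtain ⟨F₁, F₂, h⟩ := exists_eq_C_add F
  rw [congrArg (evalAt · ξ) h]
  simp only [evalAt_add, evalAt_X0_mul _ hξ, evalAt_X1_mul _ hξ, evalAt_C _ hξ, coeff_add,
    mul_comm ξ, mul_comm yy]
  rw [coeff_zero_mul (evalAt_orderTop_nonneg _ hξ) hξ,
    coeff_zero_mul (evalAt_orderTop_nonneg _ hξ) yy_pos]
  simp [HahnSeries.C_apply]

lemma ramify_one_X : ramify 1 PowerSeries.X = yy := by
  have := PowerSeries.heval_X (R := ℂ) _ yy_pos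
  rw [yy] at this
  simpa [ramify, yy] using this

lemma ramify_C (D : ℕ) (c : ℂ) : ramify D (PowerSeries.C c) = HahnSeries.C c := by
  have := PowerSeries.heval_C (R := ℂ) (x := single (1 / (D : ℚ)) (1 : ℂ)) c
  refine this.trans ?_
  rw [← HahnSeries.C_mul_eq_smul, mul_one]

lemma ramify_orderTop_nonneg {D : ℕ} (hD : 0 < D) (a : PowerSeries ℂ) :
    0 ≤ (ramify D a).orderTop :=
  orderTop_nonneg_of_mem_puiseux ⟨D, hD, a, rfl⟩

lemma evalAt_xyEquiv_symm_C (a : PowerSeries ℂ) {ξ : HahnSeries ℚ ℂ} (hξ : 0 < ξ.orderTop) :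
    evalAt (xyEquiv.symm (PowerSeries.C a)) ξ = ramify 1 a := by
  have hX : xyEquiv.symm (PowerSeries.C PowerSeries.X) = MvPowerSeries.X 1 := by
    rw [AlgEquiv.symm_apply_eq, xyEquiv_X1]
  have hC : ∀ c, xyEquiv.symm (PowerSeries.C (PowerSeries.C c)) = MvPowerSeries.C c := by
    intro c
    rw [AlgEquiv.symm_apply_eq, xyEquiv_C]
  let A : PowerSeries ℂ →+ HahnSeries ℚ ℂ :=
    (((evalHom hξ).comp (xyEquiv.symm : _ →+* MvPowerSeries (Fin 2) ℂ)).comp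
      (PowerSeries.C : PowerSeries ℂ →+* _)).toAddMonoidHom
  have hA : ∀ a, A a = evalAt (xyEquiv.symm (PowerSeries.C a)) ξ := fun _ => rfl
  have := addMonoidHom_eq_zero' yy_pos (A - (ramify 1).toAddMonoidHom) ?_ ?_ ?_ a
  · rwa [AddMonoidHom.sub_apply, sub_eq_zero] at this
  · intro F
    exact orderTop_sub_nonneg (evalAt_orderTop_nonneg _ hξ) (ramify_orderTop_nonneg one_pos _)
  · intro c
    rw [AddMonoidHom.sub_apply, hA, hC, evalAt_C _ hξ, sub_eq_zero]
    exact (ramify_C 1 c).symm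
  · intro F
    rw [AddMonoidHom.sub_apply, AddMonoidHom.sub_apply, hA, hA, map_mul, map_mul, hX,
      evalAt_X1_mul _ hξ, mul_sub]
    congr 1
    change ramify 1 _ = _ * ramify 1 _
    rw [map_mul, ramify_one_X]

/-- Both sides are ring homomorphisms in `p`, so constants and `X` suffice. This identifies
substitution into a Weierstrass polynomial with ordinary evaluation, where root counting is
available. -/
lemma evalAt_xyEquiv_symm (p : Polynomial (PowerSeries ℂ)) {ξ : HahnSeries ℚ ℂ}
    (hξ : 0 < ξ.orderTop) :
    evalAt (xyEquiv.symm (p : PowerSeries (PowerSeries ℂ))) ξ = (p.map (ramify 1)).eval ξ := by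
  have h : ((evalHom hξ).comp (xyEquiv.symm : _ →+* MvPowerSeries (Fin 2) ℂ)).comp
      (Polynomial.coeToPowerSeries.ringHom (R := PowerSeries ℂ)) =
      Polynomial.eval₂RingHom (ramify 1) ξ := by
    refine Polynomial.ringHom_ext ?_ ?_
    · intro a
      simp only [RingHom.comp_apply, Polynomial.coeToPowerSeries.ringHom_apply, Polynomial.coe_C,
        Polynomial.coe_eval₂RingHom, Polynomial.eval₂_C]
      exact evalAt_xyEquiv_symm_C a hξ
    · simp only [RingHom.comp_apply, Polynomial.coeToPowerSeries.ringHom_apply, Polynomial.coe_X,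
        Polynomial.coe_eval₂RingHom, Polynomial.eval₂_X]
      have : xyEquiv.symm PowerSeries.X = MvPowerSeries.X 0 := by
        rw [AlgEquiv.symm_apply_eq, xyEquiv_X0]
      change evalAt (xyEquiv.symm PowerSeries.X) ξ = ξ
      rw [this, evalAt_X0 hξ]
  rw [Polynomial.eval_map]
  exact DFunLike.congr_fun h p

lemma iterate_pderiv_xyEquiv_symm (p : Polynomial (PowerSeries ℂ)) (k : ℕ) :
    (MvPowerSeries.pderiv ℂ 0)^[k] (xyEquiv.symm (p : PowerSeries (PowerSeries ℂ))) =
      xyEquiv.symm ((Polynomial.derivative^[k] p : Polynomial (PowerSeries ℂ)) :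
        PowerSeries (PowerSeries ℂ)) := by
  induction k with
  | zero => rfl
  | succ k ih =>
    rw [Function.iterate_succ_apply', Function.iterate_succ_apply', ih, eq_comm,
      AlgEquiv.symm_apply_eq, xyEquiv_pderiv, AlgEquiv.apply_symm_apply,
      PowerSeries.derivative_coe]

/-- The coefficient of `y ^ 0`, on fractional power series. -/
def puiseuxResidue : puiseux →+* ℂ where
  toFun a := (a : HahnSeries ℚ ℂ).coeff 0
  map_zero' := rfl
  map_one' := by simp
  map_add' a b := by simp
  map_mul' a b := by
    classical
    obtain ⟨D, hD, h⟩ := exists_common_ramify {a, b} (fun a : puiseux => (a : HahnSeries ℚ ℂ))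
      fun a _ => a.2
    obtain ⟨f, hf⟩ := h a (by simp)
    obtain ⟨g, hg⟩ := h b (by simp)
    rw [Subring.coe_mul, ← hf, ← hg, ← map_mul, coeff_ramify_zero hD, coeff_ramify_zero hD,
      coeff_ramify_zero hD, map_mul]

/-- The non-unit `y` divides `G` only finitely often. What is left is nonzero modulo `y`, as
Weierstrass preparation requires. -/
lemma exists_eq_C_X_pow_mul {G : PowerSeries (PowerSeries ℂ)} (hG : G ≠ 0) :
    ∃ (E : ℕ) (G₁ : PowerSeries (PowerSeries ℂ)), G = PowerSeries.C PowerSeries.X ^ E * G₁ ∧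
      G₁.map (IsLocalRing.residue (PowerSeries ℂ)) ≠ 0 := by
  have hnu : ¬ IsUnit (PowerSeries.C (PowerSeries.X : PowerSeries ℂ)) := by
    rw [PowerSeries.isUnit_iff_constantCoeff, PowerSeries.constantCoeff_C,
      PowerSeries.isUnit_iff_constantCoeff, PowerSeries.constantCoeff_X]
    exact not_isUnit_zero
  obtain ⟨G₁, h1, h2⟩ := (FiniteMultiplicity.of_not_isUnit hnu hG).exists_eq_pow_mul_and_not_dvd
  refine ⟨_, G₁, h1, fun h => h2 ?_⟩
  have h3 : ∀ n, PowerSeries.X ∣ PowerSeries.coeff n G₁ := by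
    intro n
    rw [PowerSeries.X_dvd_iff, ← residue_eq_zero, ← PowerSeries.coeff_map, h, map_zero]
  choose c hc using h3
  refine ⟨PowerSeries.mk c, ?_⟩
  ext n : 1
  rw [PowerSeries.coeff_C_mul, PowerSeries.coeff_mk, hc]

/-- The monic polynomial with the given roots. -/
def rootPoly (s : Multiset (HahnSeries ℚ ℂ)) : Polynomial (HahnSeries ℚ ℂ) :=
  (s.map fun a => Polynomial.X - Polynomial.C a).prod

/-- **Newton-Puiseux factorisation** of a power series in two variables. -/
theorem exists_puiseux_factorization {F : MvPowerSeries (Fin 2) ℂ} (hF : F ≠ 0) :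
    ∃ (E : ℕ) (U W : MvPowerSeries (Fin 2) ℂ) (s : Multiset (HahnSeries ℚ ℂ)),
      F = MvPowerSeries.X 1 ^ E * U * W ∧ MvPowerSeries.constantCoeff U ≠ 0 ∧
      (∀ a ∈ s, IsArc a) ∧
      ∀ ξ : HahnSeries ℚ ℂ, 0 < ξ.orderTop → ∀ k : ℕ,
        evalAt ((MvPowerSeries.pderiv ℂ 0)^[k] W) ξ =
          (Polynomial.derivative^[k] (rootPoly s)).eval ξ := by
  obtain ⟨E, G, hFG, hG⟩ := exists_eq_C_X_pow_mul
    (G := xyEquiv F) (by simpa using hF)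
  obtain ⟨P, h, H⟩ := PowerSeries.exists_isWeierstrassFactorization hG
  have hPm : P.Monic := H.isDistinguishedAt.monic
  obtain ⟨s, hs⟩ := exists_eq_prod_X_sub_C _ (P.map (ramifyTo one_pos)) (hPm.map _) rfl
  have hprod : rootPoly (s.map puiseux.subtype) = P.map (ramify 1) := by
    have h1 : P.map (ramify 1) = (P.map (ramifyTo one_pos)).map puiseux.subtype := by
      rw [Polynomial.map_map]; rfl
    rw [h1, hs, Polynomial.map_multiset_prod, rootPoly, Multiset.map_map, Multiset.map_map]
    simp
  have hres : P.map PowerSeries.constantCoeff = Polynomial.X ^ P.natDegree := by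
    ext k
    rw [Polynomial.coeff_map, Polynomial.coeff_X_pow]
    rcases lt_trichotomy k P.natDegree with hk | hk | hk
    · rw [if_neg hk.ne, ← residue_eq_zero, IsLocalRing.residue_eq_zero_iff]
      exact H.isDistinguishedAt.mem hk
    · rw [if_pos hk, hk, hPm.coeff_natDegree, map_one]
    · rw [if_neg hk.ne', Polynomial.coeff_eq_zero_of_natDegree_lt hk, map_zero]
  have hcomp : puiseuxResidue.comp (ramifyTo one_pos) = PowerSeries.constantCoeff := by
    ext1 f
    exact coeff_ramify_zero one_pos f
  refine ⟨E, xyEquiv.symm h, xyEquiv.symm (P : PowerSeries (PowerSeries ℂ)),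
    s.map puiseux.subtype, ?_, ?_, ?_, ?_⟩
  · apply xyEquiv.injective
    rw [map_mul, map_mul, map_pow, xyEquiv_X1, AlgEquiv.apply_symm_apply,
      AlgEquiv.apply_symm_apply, hFG, H.eq_mul]
    ring
  · have hu : IsUnit (xyEquiv.symm h) := H.isUnit.map xyEquiv.symm
    exact (hu.map MvPowerSeries.constantCoeff).ne_zero
  · intro a ha
    obtain ⟨b, hb, rfl⟩ := Multiset.mem_map.1 ha
    rw [isArc_iff]
    refine ⟨?_, b.2⟩
    have h1 : (P.map (ramifyTo one_pos)).eval b = 0 := by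
      rw [hs, Polynomial.eval_multiset_prod, Multiset.map_map]
      exact Multiset.prod_eq_zero (Multiset.mem_map.2 ⟨b, hb, by simp⟩)
    -- A distinguished polynomial reduces to a power of `X` modulo `y`, so its roots have zero
    -- constant term and therefore positive order.
    have h2 : (puiseuxResidue b) ^ P.natDegree = 0 := by
      have h3 := congrArg puiseuxResidue h1
      rw [← Polynomial.eval_map_apply, Polynomial.map_map, hcomp, hres, map_zero] at h3
      simpa using h3
    have h3 : (b : HahnSeries ℚ ℂ).coeff 0 = 0 := eq_zero_of_pow_eq_zero h2
    exact lt_of_le_of_ne (orderTop_nonneg_of_mem_puiseux b.2)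
      (orderTop_ne_of_coeff_eq_zero h3).symm
  · intro ξ hξ k
    rw [iterate_pderiv_xyEquiv_symm, evalAt_xyEquiv_symm _ hξ, hprod,
      Polynomial.iterate_derivative_map]

/-! ### Multiplicities of Newton-Puiseux roots -/

lemma rootMult_eq {F : MvPowerSeries (Fin 2) ℂ} {ξ : HahnSeries ℚ ℂ} {m : ℕ}
    (h : ∀ i < m, evalAt ((MvPowerSeries.pderiv ℂ 0)^[i] F) ξ = 0)
    (hm : evalAt ((MvPowerSeries.pderiv ℂ 0)^[m] F) ξ ≠ 0) : rootMult F ξ = m := by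
  refine le_antisymm (iInf₂_le m hm) (le_iInf₂ fun i hi => ?_)
  refine Nat.cast_le.2 (not_lt.1 fun hlt => hi (h i hlt))

/-- In the Leibniz expansion only the term with all `m` derivatives on `W` survives. Hence a factor
`V` not vanishing along `ξ` does not affect `rootMult`. -/
lemma evalAt_iterate_pderiv_mul {ξ : HahnSeries ℚ ℂ} (hξ : 0 < ξ.orderTop) (m : ℕ) :
    ∀ V W : MvPowerSeries (Fin 2) ℂ,
      (∀ i < m, evalAt ((MvPowerSeries.pderiv ℂ 0)^[i] W) ξ = 0) →
      (∀ i < m, evalAt ((MvPowerSeries.pderiv ℂ 0)^[i] (V * W)) ξ = 0) ∧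
      evalAt ((MvPowerSeries.pderiv ℂ 0)^[m] (V * W)) ξ =
        evalAt V ξ * evalAt ((MvPowerSeries.pderiv ℂ 0)^[m] W) ξ := by
  have hadd : ∀ (k : ℕ) (A B : MvPowerSeries (Fin 2) ℂ), (MvPowerSeries.pderiv ℂ 0)^[k] (A + B) =
      (MvPowerSeries.pderiv ℂ 0)^[k] A + (MvPowerSeries.pderiv ℂ 0)^[k] B := fun k =>
    iterate_map_add (MvPowerSeries.pderiv ℂ 0) k
  induction m with
  | zero =>
    intro V W _
    exact ⟨by simp, by simp [evalAt_mul _ _ hξ]⟩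
  | succ m ih =>
    intro V W h
    have h1 := ih (MvPowerSeries.pderiv ℂ 0 V) W fun i hi => h i (by omega)
    have h2 := ih V (MvPowerSeries.pderiv ℂ 0 W) fun i hi => by
      rw [← Function.iterate_succ_apply]; exact h (i + 1) (by omega)
    have h3 : ∀ i, evalAt ((MvPowerSeries.pderiv ℂ 0)^[i + 1] (V * W)) ξ =
        evalAt ((MvPowerSeries.pderiv ℂ 0)^[i] (V * MvPowerSeries.pderiv ℂ 0 W)) ξ +
        evalAt ((MvPowerSeries.pderiv ℂ 0)^[i] (MvPowerSeries.pderiv ℂ 0 V * W)) ξ := by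
      intro i
      rw [Function.iterate_succ_apply, Derivation.leibniz, smul_eq_mul, smul_eq_mul, hadd,
        evalAt_add, mul_comm W]
    constructor
    · intro i hi
      rcases i with _ | i
      · rw [Function.iterate_zero_apply, evalAt_mul _ _ hξ]
        have := h 0 m.succ_pos
        rw [Function.iterate_zero_apply] at this
        rw [this, mul_zero]
      · rw [h3, h1.1 i (by omega), h2.1 i (by omega), add_zero]
    · rw [h3, h1.2, h2.2, h m m.lt_succ_self, mul_zero, add_zero, Function.iterate_succ_apply]

/-- A Newton-Puiseux factorisation `F = V ∏ (x - a)`, `a ∈ s`, up to a factor `V` which is `y ^ E`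
times a unit. -/
structure IsFactored (F : MvPowerSeries (Fin 2) ℂ) (E : ℕ) (U : MvPowerSeries (Fin 2) ℂ)
    (s : Multiset (HahnSeries ℚ ℂ)) : Prop where
  unit : MvPowerSeries.constantCoeff U ≠ 0
  arc : ∀ a ∈ s, IsArc a
  exists_eq : ∃ W : MvPowerSeries (Fin 2) ℂ, F = MvPowerSeries.X 1 ^ E * U * W ∧
    ∀ ξ : HahnSeries ℚ ℂ, 0 < ξ.orderTop → ∀ k : ℕ,
      evalAt ((MvPowerSeries.pderiv ℂ 0)^[k] W) ξ =
        (Polynomial.derivative^[k] (rootPoly s)).eval ξ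

lemma exists_isFactored {F : MvPowerSeries (Fin 2) ℂ} (hF : F ≠ 0) :
    ∃ E U s, IsFactored F E U s := by
  obtain ⟨E, U, W, s, h1, h2, h3, h4⟩ := exists_puiseux_factorization hF
  exact ⟨E, U, s, h2, h3, W, h1, h4⟩

section Factored

variable {F : MvPowerSeries (Fin 2) ℂ} {E : ℕ} {U : MvPowerSeries (Fin 2) ℂ}
  {s : Multiset (HahnSeries ℚ ℂ)}

lemma evalAt_unit_ne_zero (hU : MvPowerSeries.constantCoeff U ≠ 0) {ξ : HahnSeries ℚ ℂ}
    (hξ : 0 < ξ.orderTop) : evalAt U ξ ≠ 0 := by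
  intro h
  rw [← coeff_zero_evalAt U hξ, h] at hU
  exact hU rfl

lemma eval_rootPoly (s : Multiset (HahnSeries ℚ ℂ)) (ξ : HahnSeries ℚ ℂ) :
    (rootPoly s).eval ξ = (s.map fun a => ξ - a).prod := by
  rw [rootPoly, Polynomial.eval_multiset_prod, Multiset.map_map]
  simp

lemma yy_ne_zero : yy ≠ 0 := single_ne_zero one_ne_zero

lemma IsFactored.evalAt_eq (h : IsFactored F E U s) {ξ : HahnSeries ℚ ℂ} (hξ : 0 < ξ.orderTop) :
    evalAt F ξ = yy ^ E * evalAt U ξ * (s.map fun a => ξ - a).prod := by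
  obtain ⟨W, hF, hW⟩ := h.exists_eq
  have h0 : evalAt (MvPowerSeries.X 1 ^ E) ξ = yy ^ E := by
    rw [← evalHom_apply hξ, map_pow, evalHom_apply, evalAt_X1 hξ]
  have := hW ξ hξ 0
  rw [Function.iterate_zero_apply, Function.iterate_zero_apply] at this
  rw [hF, evalAt_mul _ _ hξ, evalAt_mul _ _ hξ, this, eval_rootPoly, h0]

open Classical in
lemma IsFactored.rootMult_eq (h : IsFactored F E U s) {ξ : HahnSeries ℚ ℂ}
    (hξ : 0 < ξ.orderTop) : rootMult F ξ = (s.count ξ : ℕ∞) := by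
  obtain ⟨W, hF, hW⟩ := h.exists_eq
  have hne : rootPoly s ≠ 0 := by
    rw [rootPoly]
    exact (Polynomial.monic_multiset_prod_of_monic _ _ fun a _ =>
      Polynomial.monic_X_sub_C a).ne_zero
  have hcount : s.count ξ = (rootPoly s).rootMultiplicity ξ := by
    rw [← Polynomial.count_roots, rootPoly, Polynomial.roots_multiset_prod_X_sub_C]
  have : CharZero (HahnSeries ℚ ℂ) :=
    charZero_of_injective_ringHom (f := HahnSeries.C (Γ := ℚ) (R := ℂ)) HahnSeries.C_injective
  have h1 : ∀ i < s.count ξ, evalAt ((MvPowerSeries.pderiv ℂ 0)^[i] W) ξ = 0 := by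
    intro i hi
    rw [hW ξ hξ]
    exact Polynomial.isRoot_iterate_derivative_of_lt_rootMultiplicity (hcount ▸ hi)
  have h2 : evalAt ((MvPowerSeries.pderiv ℂ 0)^[s.count ξ] W) ξ ≠ 0 := by
    rw [hW ξ hξ, hcount, Polynomial.eval_iterate_derivative_rootMultiplicity, nsmul_eq_mul]
    exact mul_ne_zero (Nat.cast_ne_zero.2 (Nat.factorial_ne_zero _))
      (Polynomial.eval_divByMonic_pow_rootMultiplicity_ne_zero ξ hne)
  have h3 := evalAt_iterate_pderiv_mul hξ _ (MvPowerSeries.X 1 ^ E * U) W h1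
  refine PolarTree.rootMult_eq (hF ▸ h3.1) ?_
  rw [hF, h3.2, evalAt_mul _ _ hξ, ← evalHom_apply hξ, map_pow, evalHom_apply, evalAt_X1 hξ]
  exact mul_ne_zero (mul_ne_zero (pow_ne_zero _ yy_ne_zero) (evalAt_unit_ne_zero h.unit hξ)) h2

lemma IsFactored.mem_rootSet (h : IsFactored F E U s) {ξ : HahnSeries ℚ ℂ} :
    ξ ∈ rootSet F ↔ ξ ∈ s := by
  have key : ∀ hξ : 0 < ξ.orderTop, evalAt F ξ = 0 ↔ ξ ∈ s := by
    intro hξ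
    rw [h.evalAt_eq hξ, mul_eq_zero, mul_eq_zero, Multiset.prod_eq_zero_iff, Multiset.mem_map]
    simp only [pow_eq_zero_iff', yy_ne_zero, false_and, evalAt_unit_ne_zero h.unit hξ, false_or,
      sub_eq_zero]
    exact ⟨fun ⟨a, ha, e⟩ => e ▸ ha, fun ha => ⟨ξ, ha, rfl⟩⟩
  constructor
  · rintro ⟨h1, h2⟩
    exact (key h1.1).1 h2
  · intro hs
    exact ⟨h.arc ξ hs, (key (h.arc ξ hs).1).2 hs⟩

lemma IsFactored.finite_rootSet (h : IsFactored F E U s) : (rootSet F).Finite := by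
  classical
  refine s.toFinset.finite_toSet.subset fun ξ hξ => ?_
  simpa using h.mem_rootSet.1 hξ

end Factored

/-! ### Leading terms -/

/-- `a = c y ^ q + (higher order terms)`, where `c = 0` is allowed. -/
def HasLead (a : HahnSeries ℚ ℂ) (q : ℚ) (c : ℂ) : Prop :=
  (q : WithTop ℚ) ≤ a.orderTop ∧ a.coeff q = c

lemma lt_orderTop_iff {a : HahnSeries ℚ ℂ} {q : ℚ} :
    (q : WithTop ℚ) < a.orderTop ↔ (q : WithTop ℚ) ≤ a.orderTop ∧ a.coeff q = 0 :=
  ⟨fun h => ⟨h.le, coeff_eq_zero_of_lt_orderTop h⟩,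
    fun h => lt_of_le_of_ne h.1 (orderTop_ne_of_coeff_eq_zero h.2).symm⟩

lemma le_orderTop_single (q : ℚ) (c : ℂ) : (q : WithTop ℚ) ≤ (single q c).orderTop :=
  orderTop_single_le

lemma hasLead_iff {a : HahnSeries ℚ ℂ} {q : ℚ} {c : ℂ} :
    HasLead a q c ↔ (q : WithTop ℚ) < (a - single q c).orderTop := by
  rw [lt_orderTop_iff, HasLead]
  simp only [coeff_sub, coeff_single_same, sub_eq_zero]
  refine and_congr_left fun _ => ⟨fun h => ?_, fun h => ?_⟩
  · exact le_trans (le_min h (le_orderTop_single q c)) min_orderTop_le_orderTop_sub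
  · have := le_trans (le_min h (le_orderTop_single q c)) min_orderTop_le_orderTop_add
    rwa [sub_add_cancel] at this

lemma hasLead_of_lt {a : HahnSeries ℚ ℂ} {q : ℚ} (h : (q : WithTop ℚ) < a.orderTop) :
    HasLead a q 0 := lt_orderTop_iff.1 h

lemma hasLead_single (q : ℚ) (c : ℂ) : HasLead (single q c) q c :=
  ⟨le_orderTop_single q c, coeff_single_same q c⟩

lemma hasLead_one : HasLead 1 0 1 := hasLead_single 0 1

lemma hasLead_zero (q : ℚ) : HasLead 0 q 0 := ⟨by simp, rfl⟩

namespace HasLead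

variable {a b : HahnSeries ℚ ℂ} {q r : ℚ} {c d : ℂ}

lemma orderTop_eq (h : HasLead a q c) (hc : c ≠ 0) : a.orderTop = q :=
  le_antisymm (orderTop_le_of_coeff_ne_zero (h.2.symm ▸ hc)) h.1

lemma ne_zero (h : HasLead a q c) (hc : c ≠ 0) : a ≠ 0 := by
  rintro rfl
  exact hc h.2.symm

lemma add (ha : HasLead a q c) (hb : HasLead b q d) : HasLead (a + b) q (c + d) :=
  ⟨le_trans (le_min ha.1 hb.1) min_orderTop_le_orderTop_add, by rw [coeff_add, ha.2, hb.2]⟩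

lemma neg (ha : HasLead a q c) : HasLead (-a) q (-c) :=
  ⟨by rw [orderTop_neg]; exact ha.1, by rw [coeff_neg, ha.2]⟩

lemma sub (ha : HasLead a q c) (hb : HasLead b q d) : HasLead (a - b) q (c - d) := by
  rw [sub_eq_add_neg, sub_eq_add_neg]
  exact ha.add hb.neg

lemma mul (ha : HasLead a q c) (hb : HasLead b r d) : HasLead (a * b) (q + r) (c * d) := by
  constructor
  · rw [orderTop_mul, WithTop.coe_add]
    exact add_le_add ha.1 hb.1
  · have h1 : a * b = single q c * b + (a - single q c) * b := by ring
    have h2 : ((q + r : ℚ) : WithTop ℚ) < ((a - single q c) * b).orderTop := by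
      rw [orderTop_mul, WithTop.coe_add]
      refine lt_of_lt_of_le ?_ (add_le_add_right hb.1 _)
      exact WithTop.add_lt_add_right WithTop.coe_ne_top (hasLead_iff.1 ha)
    rw [h1, coeff_add, coeff_eq_zero_of_lt_orderTop h2, add_zero, add_comm, coeff_single_mul_add,
      hb.2]

lemma weaken (ha : HasLead a q c) (hr : r < q) : HasLead a r 0 :=
  hasLead_of_lt (lt_of_lt_of_le (WithTop.coe_lt_coe.2 hr) ha.1)

lemma inv (ha : HasLead a q c) (hc : c ≠ 0) : HasLead a⁻¹ (-q) c⁻¹ := by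
  have hne := ha.ne_zero hc
  have h1 : a.orderTop + a⁻¹.orderTop = 0 := by
    rw [← orderTop_mul, mul_inv_cancel₀ hne, orderTop_one]
  have hle : ((-q : ℚ) : WithTop ℚ) ≤ a⁻¹.orderTop := by
    rw [ha.orderTop_eq hc] at h1
    obtain ⟨e, he⟩ := WithTop.ne_top_iff_exists.1 (orderTop_ne_top.2 (inv_ne_zero hne))
    rw [← he] at h1 ⊢
    have h2 : q + e = 0 := by exact_mod_cast h1
    exact WithTop.coe_le_coe.2 (by linarith)
  have h3 := ha.mul (b := a⁻¹) ⟨hle, rfl⟩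
  rw [mul_inv_cancel₀ hne, add_neg_cancel] at h3
  have h4 : c * a⁻¹.coeff (-q) = 1 := h3.2.symm.trans hasLead_one.2
  exact ⟨hle, eq_inv_of_mul_eq_one_right h4⟩

lemma div (ha : HasLead a q c) (hb : HasLead b r d) (hd : d ≠ 0) :
    HasLead (a / b) (q - r) (c / d) := by
  rw [div_eq_mul_inv, div_eq_mul_inv, sub_eq_add_neg]
  exact ha.mul (hb.inv hd)

lemma euler (ha : HasLead a q c) : HasLead (PolarTree.euler a) q (q * c) :=
  ⟨ha.1.trans (orderTop_le_euler a), by rw [coeff_euler, ha.2]⟩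

lemma unique (ha : HasLead a q c) (hc : c ≠ 0) (hb : HasLead a r d) (hd : d ≠ 0) :
    q = r ∧ c = d := by
  have h := (ha.orderTop_eq hc).symm.trans (hb.orderTop_eq hd)
  have h' : q = r := WithTop.coe_injective h
  subst h'
  exact ⟨rfl, ha.2.symm.trans hb.2⟩

lemma pow (ha : HasLead a q c) (n : ℕ) : HasLead (a ^ n) (n * q) (c ^ n) := by
  induction n with
  | zero => simpa using hasLead_one
  | succ n ih =>
    rw [pow_succ, pow_succ]
    have := ih.mul ha
    rwa [← add_one_mul, ← Nat.cast_succ] at this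

end HasLead

lemma exists_hasLead {a : HahnSeries ℚ ℂ} (ha : a ≠ 0) : ∃ q c, c ≠ 0 ∧ HasLead a q c := by
  obtain ⟨q, hq⟩ := WithTop.ne_top_iff_exists.1 (orderTop_ne_top.2 ha)
  exact ⟨q, a.coeff q, coeff_orderTop_ne hq.symm, hq.le, rfl⟩

/-! ### Leading terms along a pencil of arcs -/

open Classical in
/-- The points of contact, at height `h` over `l`, of the members of `s`: the coefficients `c` of
the members of `s` of the form `l + c y ^ h + ⋯`. -/
def contacts (l : HahnSeries ℚ ℂ) (h : ℚ) (s : Multiset (HahnSeries ℚ ℂ)) : Multiset ℂ :=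
  (s.filter fun a => (h : WithTop ℚ) ≤ (a - l).orderTop).map fun a => (a - l).coeff h

section Contacts

variable {l : HahnSeries ℚ ℂ} {h : ℚ}

lemma contacts_zero : contacts l h 0 = 0 := rfl

lemma contacts_cons_of_le {a : HahnSeries ℚ ℂ} (s : Multiset (HahnSeries ℚ ℂ))
    (ha : (h : WithTop ℚ) ≤ (a - l).orderTop) :
    contacts l h (a ::ₘ s) = (a - l).coeff h ::ₘ contacts l h s := by
  rw [contacts, Multiset.filter_cons_of_pos (p := fun a => (h : WithTop ℚ) ≤ (a - l).orderTop) s ha,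
    Multiset.map_cons]
  rfl

lemma contacts_cons_of_lt {a : HahnSeries ℚ ℂ} (s : Multiset (HahnSeries ℚ ℂ))
    (ha : (a - l).orderTop < (h : WithTop ℚ)) :
    contacts l h (a ::ₘ s) = contacts l h s := by
  rw [contacts, Multiset.filter_cons_of_neg (p := fun a => (h : WithTop ℚ) ≤ (a - l).orderTop) s
    (not_le.2 ha)]
  rfl

lemma mem_contacts {s : Multiset (HahnSeries ℚ ℂ)} {c : ℂ} :
    c ∈ contacts l h s ↔ ∃ a ∈ s, HasLead (a - l) h c := by
  rw [contacts, Multiset.mem_map]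
  constructor
  · rintro ⟨a, ha, rfl⟩
    rw [Multiset.mem_filter] at ha
    exact ⟨a, ha.1, ha.2, rfl⟩
  · rintro ⟨a, ha, h1, h2⟩
    exact ⟨a, Multiset.mem_filter.2 ⟨ha, h1⟩, h2⟩

open Classical in
lemma count_contacts (s : Multiset (HahnSeries ℚ ℂ)) (c : ℂ) :
    (contacts l h s).count c = (s.filter fun a => HasLead (a - l) h c).card := by
  rw [contacts, Multiset.count_map, Multiset.filter_filter]
  congr 1
  refine Multiset.filter_congr fun a _ => ?_
  rw [HasLead, and_comm, eq_comm (a := c)]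

lemma hasLead_sub_of_le {a ξ : HahnSeries ℚ ℂ} {z : ℂ} (hξ : HasLead (ξ - l) h z)
    (ha : (h : WithTop ℚ) ≤ (a - l).orderTop) : HasLead (ξ - a) h (z - (a - l).coeff h) := by
  have := hξ.sub (b := a - l) ⟨ha, rfl⟩
  rwa [sub_sub_sub_cancel_right] at this

/-- A root separating from `l` below height `h` is seen identically by all arcs of the pencil: `q`
and `c` depend on neither `ξ` nor `z`. -/
lemma hasLead_sub_of_lt {a : HahnSeries ℚ ℂ} (ha : (a - l).orderTop < (h : WithTop ℚ)) :
    ∃ q c, c ≠ 0 ∧ q < h ∧ ∀ ξ z, HasLead (ξ - l) h z → HasLead (ξ - a) q c := by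
  have hne : a - l ≠ 0 := by
    intro h0
    rw [h0, orderTop_zero] at ha
    simp at ha
  obtain ⟨q, c, hc, hq⟩ := exists_hasLead hne
  rw [hq.orderTop_eq hc] at ha
  have hqh : q < h := WithTop.coe_lt_coe.1 ha
  refine ⟨q, -c, neg_ne_zero.2 hc, hqh, fun ξ z hξ => ?_⟩
  have := (hξ.weaken hqh).sub hq
  rwa [sub_sub_sub_cancel_right, zero_sub] at this

lemma exists_hasLead_prod_sub (s : Multiset (HahnSeries ℚ ℂ)) :
    ∃ (ν : ℚ) (κ : ℂ), κ ≠ 0 ∧ ∀ ξ z, HasLead (ξ - l) h z →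
      HasLead (s.map fun a => ξ - a).prod ν (κ * ((contacts l h s).map fun c => z - c).prod) := by
  induction s using Multiset.induction_on with
  | empty =>
    refine ⟨0, 1, one_ne_zero, fun ξ z _ => ?_⟩
    simpa [contacts_zero] using hasLead_one
  | cons a s ih =>
    obtain ⟨ν, κ, hκ, hs⟩ := ih
    rcases le_or_gt (h : WithTop ℚ) (a - l).orderTop with ha | ha
    · refine ⟨h + ν, κ, hκ, fun ξ z hξ => ?_⟩
      have := (hasLead_sub_of_le hξ ha).mul (hs ξ z hξ)
      rwa [contacts_cons_of_le s ha, Multiset.map_cons, Multiset.map_cons, Multiset.prod_cons,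
        Multiset.prod_cons, mul_left_comm]
    · obtain ⟨q, c, hc, -, hq⟩ := hasLead_sub_of_lt ha
      refine ⟨q + ν, c * κ, mul_ne_zero hc hκ, fun ξ z hξ => ?_⟩
      have := (hq ξ z hξ).mul (hs ξ z hξ)
      rwa [contacts_cons_of_lt s ha, Multiset.map_cons, Multiset.prod_cons, mul_assoc]

/-- Roots off the pencil contribute inverses of order above `-h`, so only the contact points appear
in the leading coefficient. -/
lemma hasLead_sum_inv_sub (s : Multiset (HahnSeries ℚ ℂ)) {ξ : HahnSeries ℚ ℂ} {z : ℂ}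
    (hξ : HasLead (ξ - l) h z) (hz : z ∉ contacts l h s) :
    HasLead (s.map fun a => (ξ - a)⁻¹).sum (-h) ((contacts l h s).map fun c => (z - c)⁻¹).sum := by
  induction s using Multiset.induction_on with
  | empty => simpa [contacts_zero] using hasLead_zero (-h)
  | cons a s ih =>
    rcases le_or_gt (h : WithTop ℚ) (a - l).orderTop with ha | ha
    · rw [contacts_cons_of_le s ha] at hz ⊢
      rw [Multiset.mem_cons, not_or] at hz
      rw [Multiset.map_cons, Multiset.map_cons, Multiset.sum_cons, Multiset.sum_cons]
      exact ((hasLead_sub_of_le hξ ha).inv (sub_ne_zero.2 hz.1)).add (ih hz.2)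
    · rw [contacts_cons_of_lt s ha] at hz ⊢
      obtain ⟨q, c, hc, hqh, hq⟩ := hasLead_sub_of_lt ha
      have := (((hq ξ z hξ).inv hc).weaken (neg_lt_neg hqh)).add (ih hz)
      rwa [zero_add, ← Multiset.sum_cons, ← Multiset.map_cons (fun a => (ξ - a)⁻¹)] at this

lemma sub_ne_zero_of_notMem_contacts {s : Multiset (HahnSeries ℚ ℂ)} {ξ : HahnSeries ℚ ℂ} {z : ℂ}
    (hξ : HasLead (ξ - l) h z) (hz : z ∉ contacts l h s) {a : HahnSeries ℚ ℂ} (ha : a ∈ s) :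
    ξ - a ≠ 0 := by
  intro h0
  rw [sub_eq_zero] at h0
  subst h0
  exact hz (mem_contacts.2 ⟨ξ, ha, hξ⟩)

variable {F : MvPowerSeries (Fin 2) ℂ} {E : ℕ} {U : MvPowerSeries (Fin 2) ℂ}
  {s : Multiset (HahnSeries ℚ ℂ)}

lemma orderTop_pos_of_hasLead (hl : 0 < l.orderTop) (hh : 0 < h) {ξ : HahnSeries ℚ ℂ} {z : ℂ}
    (hξ : HasLead (ξ - l) h z) : 0 < ξ.orderTop := by
  have h1 : 0 < (ξ - l).orderTop := lt_of_lt_of_le (WithTop.coe_lt_coe.2 hh) hξ.1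
  have := lt_of_lt_of_le (lt_min h1 hl) min_orderTop_le_orderTop_add
  rwa [sub_add_cancel] at this

/-- The leading term of `F(ξ(y), y)` for `ξ = l + z y ^ h + ⋯`. -/
lemma IsFactored.exists_hasLead (hF : IsFactored F E U s) (hl : 0 < l.orderTop) (hh : 0 < h) :
    ∃ (ν : ℚ) (κ : ℂ), κ ≠ 0 ∧ ∀ ξ z, HasLead (ξ - l) h z →
      HasLead (evalAt F ξ) ν (κ * ((contacts l h s).map fun c => z - c).prod) := by
  obtain ⟨ν, κ, hκ, hs⟩ := exists_hasLead_prod_sub (l := l) (h := h) s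
  refine ⟨E * 1 + 0 + ν, 1 ^ E * MvPowerSeries.constantCoeff U * κ,
    mul_ne_zero (mul_ne_zero (pow_ne_zero _ one_ne_zero) hF.unit) hκ, fun ξ z hξ => ?_⟩
  have hξ0 := orderTop_pos_of_hasLead hl hh hξ
  rw [hF.evalAt_eq hξ0, mul_assoc (1 ^ E * _)]
  have h1 : HasLead yy 1 1 := hasLead_single 1 1
  have h2 : HasLead (evalAt U ξ) 0 (MvPowerSeries.constantCoeff U) :=
    ⟨evalAt_orderTop_nonneg _ hξ0, coeff_zero_evalAt U hξ0⟩
  exact ((h1.pow E).mul h2).mul (hs ξ z hξ)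

/-- The leading term of the logarithmic derivative `F_x / F` at `ξ = l + z y ^ h + ⋯`. -/
lemma IsFactored.hasLead_logDeriv (hF : IsFactored F E U s) (hl : 0 < l.orderTop) (hh : 0 < h)
    {ξ : HahnSeries ℚ ℂ} {z : ℂ} (hξ : HasLead (ξ - l) h z) (hz : z ∉ contacts l h s) :
    HasLead (evalAt (MvPowerSeries.pderiv ℂ 0 F) ξ / evalAt F ξ) (-h)
      ((contacts l h s).map fun c => (z - c)⁻¹).sum := by
  have hξ0 := orderTop_pos_of_hasLead hl hh hξ
  obtain ⟨W, hFW, hW⟩ := hF.exists_eq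
  have hW0 := hW ξ hξ0 0
  have hW1 := hW ξ hξ0 1
  rw [Function.iterate_zero_apply, Function.iterate_zero_apply] at hW0
  rw [Function.iterate_one, Function.iterate_one] at hW1
  have hP : (rootPoly s).eval ξ ≠ 0 := by
    rw [eval_rootPoly, Ne, Multiset.prod_eq_zero_iff, Multiset.mem_map]
    rintro ⟨a, ha, h0⟩
    exact sub_ne_zero_of_notMem_contacts hξ hz ha h0
  have hlog : (Polynomial.derivative (rootPoly s)).eval ξ / (rootPoly s).eval ξ =
      (s.map fun a => (ξ - a)⁻¹).sum := by
    have hsp : (rootPoly s).Splits :=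
      Polynomial.Splits.multisetProd (by
        intro p hp
        obtain ⟨a, -, rfl⟩ := Multiset.mem_map.1 hp
        exact Polynomial.Splits.X_sub_C a)
    rw [hsp.eval_derivative_div_eval_of_ne_zero hP, rootPoly,
      Polynomial.roots_multiset_prod_X_sub_C]
    simp
  have hU := evalAt_unit_ne_zero hF.unit hξ0
  have hUl : HasLead (evalAt U ξ) 0 (MvPowerSeries.constantCoeff U) :=
    ⟨evalAt_orderTop_nonneg _ hξ0, coeff_zero_evalAt U hξ0⟩
  have hUx : HasLead (evalAt (MvPowerSeries.pderiv ℂ 0 U) ξ) 0 _ :=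
    ⟨evalAt_orderTop_nonneg _ hξ0, rfl⟩
  have hYE : evalAt (MvPowerSeries.X 1 ^ E) ξ = yy ^ E := by
    rw [← evalHom_apply hξ0, map_pow, evalHom_apply, evalAt_X1 hξ0]
  have hdY : MvPowerSeries.pderiv ℂ (0 : Fin 2) (MvPowerSeries.X 1 ^ E) = 0 := by
    rw [Derivation.leibniz_pow, MvPowerSeries.pderiv_X_of_ne (by decide), smul_zero, smul_zero]
  have hFx : evalAt (MvPowerSeries.pderiv ℂ 0 F) ξ = yy ^ E *
      (evalAt (MvPowerSeries.pderiv ℂ 0 U) ξ * (rootPoly s).eval ξ +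
        evalAt U ξ * (Polynomial.derivative (rootPoly s)).eval ξ) := by
    rw [hFW, Derivation.leibniz, Derivation.leibniz, hdY, smul_zero, add_zero]
    simp only [smul_eq_mul, evalAt_add, evalAt_mul _ _ hξ0, hW0, hW1, hYE]
    ring
  have hF0 : evalAt F ξ = yy ^ E * (evalAt U ξ * (rootPoly s).eval ξ) := by
    rw [hFW, evalAt_mul _ _ hξ0, evalAt_mul _ _ hξ0, hW0, hYE, mul_assoc]
  have hq : evalAt (MvPowerSeries.pderiv ℂ 0 F) ξ / evalAt F ξ =
      evalAt (MvPowerSeries.pderiv ℂ 0 U) ξ / evalAt U ξ +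
        (s.map fun a => (ξ - a)⁻¹).sum := by
    rw [hFx, hF0, mul_div_mul_left _ _ (pow_ne_zero _ yy_ne_zero), ← hlog]
    field_simp
  -- The power of `y` has zero `x`-derivative, and `U_x / U` has order at least `0 > -h`, so neither
  -- affects the leading term.
  rw [hq, ← zero_add (Multiset.sum (Multiset.map _ (contacts l h s)))]
  exact ((hUx.div hUl hF.unit).weaken (by linarith)).add (hasLead_sum_inv_sub s hξ hz)

/-- The leading term of the Jacobian at `ξ = l + z y ^ h + ⋯`. -/
lemma hasLead_jac {f g : MvPowerSeries (Fin 2) ℂ} (hl : 0 < l.orderTop) (hh : 0 < h)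
    {ξ : HahnSeries ℚ ℂ} {z : ℂ} (hξ : HasLead (ξ - l) h z) {μ ν : ℚ} {a b S T : ℂ}
    (hf : HasLead (evalAt f ξ) μ a) (ha : a ≠ 0) (hg : HasLead (evalAt g ξ) ν b) (hb : b ≠ 0)
    (hS : HasLead (evalAt (MvPowerSeries.pderiv ℂ 0 f) ξ / evalAt f ξ) (-h) S)
    (hT : HasLead (evalAt (MvPowerSeries.pderiv ℂ 0 g) ξ / evalAt g ξ) (-h) T) :
    HasLead (evalAt (jac f g) ξ) (μ + ν - h - 1) (a * b * (μ * T - ν * S)) := by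
  have hξ0 := orderTop_pos_of_hasLead hl hh hξ
  have hfx := hS.mul hf
  have hgx := hT.mul hg
  rw [div_mul_cancel₀ _ (hf.ne_zero ha)] at hfx
  rw [div_mul_cancel₀ _ (hg.ne_zero hb)] at hgx
  -- `euler` multiplies the leading coefficient by the order; this is how `μ` and `ν` enter.
  have h1 := hf.euler.mul hgx
  have h2 := hfx.mul hg.euler
  rw [show -h + μ + ν = μ + (-h + ν) by ring] at h2
  have h3 := (hasLead_single (-1) (1 : ℂ)).mul (h1.sub h2)
  have hy : single (-1 : ℚ) (1 : ℂ) * yy = 1 := by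
    rw [yy, single_mul_single, neg_add_cancel, one_mul]; rfl
  -- By the chain rule both products contain `f_x g_x θ(ξ)`, which cancels and leaves `y J`.
  have hJ : evalAt (jac f g) ξ = single (-1) (1 : ℂ) *
      (euler (evalAt f ξ) * evalAt (MvPowerSeries.pderiv ℂ 0 g) ξ -
        evalAt (MvPowerSeries.pderiv ℂ 0 f) ξ * euler (evalAt g ξ)) := by
    rw [euler_evalAt f hξ0, euler_evalAt g hξ0, jac, ← evalHom_apply hξ0 (_ - _), map_sub, map_mul,
      map_mul]
    simp only [evalHom_apply]
    linear_combination (-(evalAt (MvPowerSeries.pderiv ℂ 1 f) ξ *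
      evalAt (MvPowerSeries.pderiv ℂ 0 g) ξ - evalAt (MvPowerSeries.pderiv ℂ 0 f) ξ *
      evalAt (MvPowerSeries.pderiv ℂ 1 g) ξ)) * hy
  rw [hJ]
  convert h3 using 1 <;> ring

end Contacts

/-! ### Partial fractions with simple poles -/

section PartialFractions

variable (Z : Finset ℂ) (d : ℂ → ℂ)

/-- The numerator of `∑ d c / (X - c)`, `c ∈ Z`, over the common denominator `∏ (X - c)`. -/
def pfNum : Polynomial ℂ :=
  ∑ c ∈ Z, Polynomial.C (d c) * ∏ b ∈ Z.erase c, (Polynomial.X - Polynomial.C b)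

/-- The common denominator `∏ (X - c)`, `c ∈ Z`. -/
def pfDen : Polynomial ℂ := ∏ c ∈ Z, (Polynomial.X - Polynomial.C c)

/-- The rational function `∑ d c / (X - c)`, `c ∈ Z`. -/
def pf : RatFunc ℂ := ∑ c ∈ Z, RatFunc.C (d c) / (RatFunc.X - RatFunc.C c)

lemma pf_mul_pfDen :
    pf Z d * algebraMap (Polynomial ℂ) (RatFunc ℂ) (pfDen Z) =
      algebraMap (Polynomial ℂ) (RatFunc ℂ) (pfNum Z d) := by
  rw [pf, pfDen, pfNum, Finset.sum_mul, map_sum]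
  refine Finset.sum_congr rfl fun c hc => ?_
  have hne : (RatFunc.X - RatFunc.C c : RatFunc ℂ) ≠ 0 := by
    rw [← RatFunc.algebraMap_X, ← RatFunc.algebraMap_C, ← map_sub]
    exact RatFunc.algebraMap_ne_zero (Polynomial.X_sub_C_ne_zero c)
  rw [← Finset.mul_prod_erase Z _ hc, map_mul, map_mul, map_sub, RatFunc.algebraMap_X,
    RatFunc.algebraMap_C, RatFunc.algebraMap_C]
  field_simp

/-- Cross-multiplication links the reduced fraction, in which zeros of `M_B` are defined, to the
explicit one, which may have common factors where `d c = 0`. -/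
lemma num_mul_pfDen : (pf Z d).num * pfDen Z = (pf Z d).denom * pfNum Z d := by
  apply RatFunc.algebraMap_injective ℂ
  rw [map_mul, map_mul, ← pf_mul_pfDen, ← mul_assoc]
  congr 1
  have h0 := RatFunc.algebraMap_ne_zero (RatFunc.denom_ne_zero (pf Z d))
  conv_rhs => rw [← RatFunc.num_div_denom (pf Z d)]
  rw [RatFunc.num_div_denom, mul_comm, ← div_eq_iff h0, RatFunc.num_div_denom]

variable {Z d}

lemma pfNum_eval_of_mem {z : ℂ} (hz : z ∈ Z) :
    (pfNum Z d).eval z = d z * ∏ b ∈ Z.erase z, (z - b) := by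
  rw [pfNum, Polynomial.eval_finsetSum, Finset.sum_eq_single_of_mem z hz]
  · simp [Polynomial.eval_prod]
  · intro c _ hcz
    rw [Polynomial.eval_mul, Polynomial.eval_prod,
      Finset.prod_eq_zero (Finset.mem_erase.2 ⟨hcz.symm, hz⟩) (by simp), mul_zero]

lemma pfNum_eval_ne_zero {z : ℂ} (hz : z ∈ Z) (hd : d z ≠ 0) : (pfNum Z d).eval z ≠ 0 := by
  rw [pfNum_eval_of_mem hz]
  refine mul_ne_zero hd (Finset.prod_ne_zero_iff.2 fun b hb => ?_)
  exact sub_ne_zero.2 (Finset.ne_of_mem_erase hb).symm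

lemma pfDen_eval_ne_zero {z : ℂ} (hz : z ∉ Z) : (pfDen Z).eval z ≠ 0 := by
  rw [pfDen, Polynomial.eval_prod]
  refine Finset.prod_ne_zero_iff.2 fun b hb => ?_
  rw [Polynomial.eval_sub, Polynomial.eval_X, Polynomial.eval_C]
  exact sub_ne_zero.2 fun h => hz (h ▸ hb)

lemma pfNum_eval_of_notMem {z : ℂ} (hz : z ∉ Z) :
    (pfNum Z d).eval z = (pfDen Z).eval z * ∑ c ∈ Z, d c * (z - c)⁻¹ := by
  rw [pfNum, pfDen, Polynomial.eval_finsetSum, Finset.mul_sum]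
  refine Finset.sum_congr rfl fun c hc => ?_
  have hne : z - c ≠ 0 := sub_ne_zero.2 fun h => hz (h ▸ hc)
  rw [← Finset.mul_prod_erase Z _ hc]
  simp only [Polynomial.eval_mul, Polynomial.eval_sub, Polynomial.eval_X, Polynomial.eval_C]
  field_simp

lemma rootMultiplicity_mul_of_eval_ne_zero {p q : Polynomial ℂ} {z : ℂ} (hp : p ≠ 0)
    (hq : q.eval z ≠ 0) : (p * q).rootMultiplicity z = p.rootMultiplicity z := by
  have hq0 : q ≠ 0 := by rintro rfl; simp at hq
  rw [Polynomial.rootMultiplicity_mul (mul_ne_zero hp hq0), Polynomial.rootMultiplicity_eq_zero hq,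
    add_zero]

lemma denom_eval_ne_zero {z : ℂ} {r : RatFunc ℂ} (hz : r.num.IsRoot z) : r.denom.eval z ≠ 0 := by
  obtain ⟨a, b, hab⟩ := RatFunc.isCoprime_num_denom r
  intro h
  have := congrArg (Polynomial.eval z) hab
  rw [Polynomial.eval_add, Polynomial.eval_mul, Polynomial.eval_mul, h, hz.eq_zero] at this
  simp at this

/-- A nonzero residue leaves a genuine pole, where the reduced numerator cannot vanish. -/
lemma notMem_of_isRoot_num {z : ℂ} (hz : (pf Z d).num.IsRoot z) (hd : z ∈ Z → d z ≠ 0) :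
    z ∉ Z := by
  intro hmem
  have h := congrArg (Polynomial.eval z) (num_mul_pfDen Z d)
  rw [Polynomial.eval_mul, Polynomial.eval_mul, hz.eq_zero, zero_mul, eq_comm, mul_eq_zero] at h
  exact h.elim (denom_eval_ne_zero hz) (pfNum_eval_ne_zero hmem (hd hmem))

lemma rootMultiplicity_num {z : ℂ} (hz : (pf Z d).num.IsRoot z) (hZ : z ∉ Z)
    (hN : pfNum Z d ≠ 0) :
    (pf Z d).num.rootMultiplicity z = (pfNum Z d).rootMultiplicity z := by
  have hnum : (pf Z d).num ≠ 0 := by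
    intro h
    have h1 := num_mul_pfDen Z d
    rw [h, zero_mul, eq_comm] at h1
    exact mul_ne_zero (RatFunc.denom_ne_zero _) hN h1
  rw [← rootMultiplicity_mul_of_eval_ne_zero hnum (pfDen_eval_ne_zero hZ), num_mul_pfDen, mul_comm,
    rootMultiplicity_mul_of_eval_ne_zero hN (denom_eval_ne_zero hz)]

end PartialFractions

/-! ### Bars -/

section Bars

variable {Λ : Set (HahnSeries ℚ ℂ)} {B : Bar}

lemma orderTop_sub_comm (a b : HahnSeries ℚ ℂ) : (a - b).orderTop = (b - a).orderTop := by
  rw [← orderTop_neg, neg_sub]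

lemma lt_orderTop_sub_trans {q : WithTop ℚ} {a b c : HahnSeries ℚ ℂ} (h1 : q < (a - b).orderTop)
    (h2 : q < (b - c).orderTop) : q < (a - c).orderTop := by
  have := lt_of_lt_of_le (lt_min h1 h2) min_orderTop_le_orderTop_add
  rwa [sub_add_sub_cancel] at this

lemma le_orderTop_sub_trans {q : WithTop ℚ} {a b c : HahnSeries ℚ ℂ} (h1 : q ≤ (a - b).orderTop)
    (h2 : q ≤ (b - c).orderTop) : q ≤ (a - c).orderTop := by
  have := le_trans (le_min h1 h2) min_orderTop_le_orderTop_add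
  rwa [sub_add_sub_cancel] at this

/-- The bar carries exactly the roots which agree with one of its members up to its height, and
only the ground bar has height `0`. -/
lemma IsBar.roots_spec (hΛ : ∀ l ∈ Λ, 0 < l.orderTop) (hB : IsBar Λ B) :
    B.roots ⊆ Λ ∧
    (∀ l ∈ B.roots, ∀ l' ∈ B.roots, (B.height : WithTop ℚ) ≤ (l - l').orderTop) ∧
    (∀ l ∈ B.roots, ∀ ξ ∈ Λ, (B.height : WithTop ℚ) ≤ (l - ξ).orderTop → ξ ∈ B.roots) ∧
    (B = ⟨0, Λ⟩ ∨ 0 < B.height) := by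
  induction hB with
  | ground =>
    refine ⟨subset_rfl, fun l hl l' hl' => ?_, fun _ _ ξ hξ _ => hξ, Or.inl rfl⟩
    exact orderTop_sub_nonneg (hΛ l hl).le (hΛ l' hl').le
  | post B T h hB hT hh ih =>
    obtain ⟨h1, h2, h3, h4⟩ := ih
    obtain ⟨l₀, hl₀, rfl⟩ := hT
    -- Members of a trunk agree with `l₀`, hence with each other, beyond `B.height`.
    have hlt : B.height < h := by
      obtain ⟨l, hl, l', hl', e⟩ := hh.1
      rw [← WithTop.coe_lt_coe, e]
      refine lt_orderTop_sub_trans (b := l₀) ?_ hl'.2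
      rw [orderTop_sub_comm]
      exact hl.2
    refine ⟨fun l hl => h1 hl.1, fun l hl l' hl' => hh.2 ⟨l, hl, l', hl', rfl⟩, ?_, Or.inr ?_⟩
    · intro l hl ξ hξ hle
      have hlt' : (B.height : WithTop ℚ) < (l - ξ).orderTop :=
        lt_of_lt_of_le (WithTop.coe_lt_coe.2 hlt) hle
      exact ⟨h3 l hl.1 ξ hξ hlt'.le, lt_orderTop_sub_trans hl.2 hlt'⟩
    · rcases h4 with h4 | h4
      · rw [h4] at hlt; exact hlt
      · exact h4.trans hlt

lemma Bar.climbsAt_iff {ξ : HahnSeries ℚ ℂ} {c : ℂ} :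
    B.ClimbsAt ξ c ↔ HasLead (ξ - B.stem) B.height c := by
  rw [hasLead_iff, Bar.ClimbsAt, Bar.point, sub_add_eq_sub_sub]

lemma Bar.hasTrunkAt_iff {c : ℂ} : B.HasTrunkAt c ↔ ∃ l ∈ B.roots, B.ClimbsAt l c := by
  constructor
  · rintro ⟨T, ⟨l₀, hl₀, rfl⟩, l, hl, hc⟩
    exact ⟨l, hl.1, hc⟩
  · rintro ⟨l, hl, hc⟩
    exact ⟨_, ⟨l, hl, rfl⟩, l, ⟨hl, by simp⟩, hc⟩

lemma Bar.finite_hasTrunkAt (h : B.roots.Finite) : {c | B.HasTrunkAt c}.Finite := by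
  refine (h.image fun l => (l - B.stem).coeff B.height).subset fun c hc => ?_
  obtain ⟨l, hl, hlc⟩ := Bar.hasTrunkAt_iff.1 hc
  exact ⟨l, hl, (Bar.climbsAt_iff.1 hlc).2⟩

lemma Bar.stem_eq (h : B.roots.Nonempty) : ∃ l ∈ B.roots, B.stem = truncLT B.height l := by
  rw [Bar.stem, dif_pos h]
  exact ⟨_, h.some_mem, rfl⟩

lemma le_orderTop_sub_truncLT (h : ℚ) (l : HahnSeries ℚ ℂ) :
    (h : WithTop ℚ) ≤ (l - truncLT h l).orderTop := by
  rw [le_orderTop_iff_forall]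
  intro q hq
  rw [coeff_sub, coeff_truncLT_of_lt (WithTop.coe_lt_coe.1 hq), sub_self]

lemma orderTop_truncLT_pos {h : ℚ} {l : HahnSeries ℚ ℂ} (hl : 0 < l.orderTop) :
    0 < (truncLT h l).orderTop := by
  rw [← WithTop.coe_zero, lt_orderTop_iff, le_orderTop_iff_forall]
  rw [← WithTop.coe_zero, lt_orderTop_iff, le_orderTop_iff_forall] at hl
  simp only [HahnSeries.coeff_truncLT]
  refine ⟨fun q hq => ?_, ?_⟩
  · rw [hl.1 q hq, ite_self]
  · rw [hl.2, ite_self]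

lemma IsBar.stem_pos (hΛ : ∀ l ∈ Λ, 0 < l.orderTop) (hB : IsBar Λ B) (hne : B.roots.Nonempty) :
    0 < B.stem.orderTop := by
  obtain ⟨l, hl, h⟩ := Bar.stem_eq hne
  rw [h]
  exact orderTop_truncLT_pos (hΛ l ((hB.roots_spec hΛ).1 hl))

/-- Contact with the stem up to the height already forces membership, so contacts can be counted
over all the roots. -/
lemma IsBar.mem_roots (hΛ : ∀ l ∈ Λ, 0 < l.orderTop) (hB : IsBar Λ B) (hne : B.roots.Nonempty)
    {ξ : HahnSeries ℚ ℂ} {c : ℂ} (hξ : ξ ∈ Λ) (hc : HasLead (ξ - B.stem) B.height c) :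
    ξ ∈ B.roots := by
  obtain ⟨l, hl, h⟩ := Bar.stem_eq hne
  refine (hB.roots_spec hΛ).2.2.1 l hl ξ hξ (le_orderTop_sub_trans (b := B.stem) ?_ ?_)
  · rw [h]; exact le_orderTop_sub_truncLT _ _
  · rw [orderTop_sub_comm]; exact hc.1

lemma IsBar.exists_pf (hΛ : Λ.Finite) (hΛ' : ∀ l ∈ Λ, 0 < l.orderTop) (hB : IsBar Λ B)
    (f g : MvPowerSeries (Fin 2) ℂ) :
    ∃ Z : Finset ℂ, (∀ c, c ∈ Z ↔ B.HasTrunkAt c) ∧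
      B.mero f g = pf Z fun c => ((B.delta f g c : ℚ) : ℂ) := by
  have hfin := Bar.finite_hasTrunkAt (hΛ.subset (hB.roots_spec hΛ').1)
  refine ⟨hfin.toFinset, fun c => by simp, ?_⟩
  rw [Bar.mero, pf, finsum_mem_eq_finite_toFinset_sum _ hfin]

/-- There are no pure mero-zeros on the ground bar. -/
lemma not_isPureMeroZero_ground (hΛ : Λ.Finite) (hΛ' : ∀ l ∈ Λ, 0 < l.orderTop)
    {f g : MvPowerSeries (Fin 2) ℂ} (hnc : (⟨0, Λ⟩ : Bar).IsNonCollinear f g) (z : ℂ) :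
    ¬ (⟨0, Λ⟩ : Bar).IsPureMeroZero f g z := by
  rintro ⟨hz, hz'⟩
  obtain ⟨Z, hZ, hM⟩ := (IsBar.ground (Λ := Λ)).exists_pf hΛ hΛ' f g
  -- All roots have positive order, so at height `0` their coefficient is `0`; `M_B` has a single
  -- term `d / z`, with `d ≠ 0` by non-collinearity.
  have h0 : ∀ c, (⟨0, Λ⟩ : Bar).HasTrunkAt c → c = 0 := by
    intro c hc
    obtain ⟨l, hl, hlc⟩ := Bar.hasTrunkAt_iff.1 hc
    have h1 := (Bar.climbsAt_iff.1 hlc).2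
    have h2 := (IsBar.ground (Λ := Λ)).stem_pos hΛ' ⟨l, hl⟩
    rw [← WithTop.coe_zero, lt_orderTop_iff] at h2
    have h3 := hΛ' l hl
    rw [← WithTop.coe_zero, lt_orderTop_iff] at h3
    rw [← h1, coeff_sub]
    change l.coeff 0 - (Bar.stem _).coeff 0 = 0
    rw [h2.2, h3.2, sub_zero]
  obtain ⟨c, hc, hd⟩ := hnc
  obtain rfl := h0 c hc
  have hZ0 : Z = {0} := by
    ext c
    rw [hZ, Finset.mem_singleton]
    exact ⟨h0 c, fun h => h ▸ hc⟩
  rw [Bar.IsMeroZero, hM] at hz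
  have hd' : (((⟨0, Λ⟩ : Bar).delta f g 0 : ℚ) : ℂ) ≠ 0 := Rat.cast_ne_zero.2 hd
  have hzZ : z ∉ Z := notMem_of_isRoot_num hz fun h => by
    rw [hZ0, Finset.mem_singleton] at h
    rw [h]; exact hd'
  have h := congrArg (Polynomial.eval z) (num_mul_pfDen Z
    fun c => (((⟨0, Λ⟩ : Bar).delta f g c : ℚ) : ℂ))
  rw [Polynomial.eval_mul, Polynomial.eval_mul, hz.eq_zero, zero_mul, eq_comm, mul_eq_zero] at h
  refine h.elim (denom_eval_ne_zero hz) ?_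
  rw [hZ0, pfNum]
  simpa using hd'

end Bars

/-! ### Simple roots -/

lemma evalAt_pderiv_ne_zero {F : MvPowerSeries (Fin 2) ℂ} {ξ : HahnSeries ℚ ℂ}
    (h0 : evalAt F ξ = 0) (h : rootMult F ξ = 1) : evalAt (MvPowerSeries.pderiv ℂ 0 F) ξ ≠ 0 := by
  intro h1
  have : (2 : ℕ∞) ≤ rootMult F ξ := by
    refine le_iInf₂ fun i hi => ?_
    rcases i with _ | _ | i
    · exact absurd h0 hi
    · exact absurd h1 hi
    · exact_mod_cast Nat.le_add_left 2 i
  rw [h] at this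
  exact absurd this (by decide)

/-- At a root of `f` one has `(f g)_x = f_x g`, so simplicity for `f * g` gives `f_x ≠ 0`. -/
lemma IsFactored.nodup {f g : MvPowerSeries (Fin 2) ℂ} {E : ℕ} {U : MvPowerSeries (Fin 2) ℂ}
    {s : Multiset (HahnSeries ℚ ℂ)} (h : IsFactored f E U s)
    (hs : ∀ l ∈ rootSet (f * g), rootMult (f * g) l = 1) : s.Nodup := by
  classical
  rw [Multiset.nodup_iff_count_le_one]
  intro l
  by_cases hl : l ∈ s
  · obtain ⟨harc, h0⟩ := h.mem_rootSet.2 hl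
    have hfg : evalAt (f * g) l = 0 := by rw [evalAt_mul _ _ harc.1, h0, zero_mul]
    have h1 := evalAt_pderiv_ne_zero hfg (hs l ⟨harc, hfg⟩)
    rw [Derivation.leibniz, smul_eq_mul, smul_eq_mul, evalAt_add, evalAt_mul _ _ harc.1, h0,
      zero_mul, zero_add, evalAt_mul _ _ harc.1] at h1
    have h2 : rootMult f l = (1 : ℕ) := by
      refine PolarTree.rootMult_eq (fun i hi => ?_) (right_ne_zero_of_mul h1)
      obtain rfl : i = 0 := by omega
      exact h0
    rw [h.rootMult_eq harc.1] at h2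
    exact (Nat.cast_inj.1 h2).le
  · rw [Multiset.count_eq_zero_of_notMem hl]
    exact Nat.zero_le _

/-! ### Invariants of a bar of positive height -/

section Invariants

variable {Λ : Set (HahnSeries ℚ ℂ)} {B : Bar} {F : MvPowerSeries (Fin 2) ℂ} {E : ℕ}
  {U : MvPowerSeries (Fin 2) ℂ} {s : Multiset (HahnSeries ℚ ℂ)}

lemma hasLead_point (B : Bar) (z : ℂ) : HasLead (B.point z - B.stem) B.height z := by
  rw [Bar.point, add_sub_cancel_left]
  exact hasLead_single _ _

lemma prod_sub_ne_zero {m : Multiset ℂ} {z : ℂ} (hz : z ∉ m) : (m.map fun c => z - c).prod ≠ 0 := by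
  rw [Ne, Multiset.prod_eq_zero_iff, Multiset.mem_map]
  rintro ⟨c, hc, h⟩
  rw [sub_eq_zero] at h
  exact hz (h ▸ hc)

/-- The generic order along a bar is the order of the leading term. -/
lemma Bar.nu_eq (hh : 0 < B.height) {ν : ℚ} {κ : ℂ} (hκ : κ ≠ 0) {m : Multiset ℂ}
    (h : ∀ ξ z, HasLead (ξ - B.stem) B.height z →
      HasLead (evalAt F ξ) ν (κ * (m.map fun c => z - c).prod)) : B.nu F = ν := by
  classical
  have hev : ∀ᶠ z : ℂ in Filter.cofinite,
      (evalAt F (B.point z)).orderTop = (ν : WithTop ℚ) := by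
    have hfin : ∀ᶠ z : ℂ in Filter.cofinite, z ∉ m.toFinset :=
      m.toFinset.finite_toSet.eventually_cofinite_notMem
    filter_upwards [hfin] with z hz
    rw [Multiset.mem_toFinset] at hz
    exact (h _ z (hasLead_point B z)).orderTop_eq (mul_ne_zero hκ (prod_sub_ne_zero hz))
  have hex : ∃ v : ℚ, ∀ᶠ z : ℂ in Filter.cofinite,
      (evalAt F (B.point z)).orderTop = (v : WithTop ℚ) := ⟨ν, hev⟩
  rw [Bar.nu, if_neg hh.ne', dif_pos hex]
  -- Two cofinite conditions on the infinite set `ℂ` share a point, so the chosen value is `ν`.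
  obtain ⟨z, h1, h2⟩ := (hex.choose_spec.and hev).exists
  exact WithTop.coe_injective (h1.symm.trans h2)

-- `trunkCount` is the cardinality of a set and `contacts` counts with multiplicity; they agree
-- because the roots are distinct.
open Classical in
lemma IsBar.trunkCount_eq (hΛ : ∀ l ∈ Λ, 0 < l.orderTop) (hB : IsBar Λ B) (hne : B.roots.Nonempty)
    (hF : IsFactored F E U s) (hs : s.Nodup) (hsub : rootSet F ⊆ Λ) (c : ℂ) :
    B.trunkCount F c = (contacts B.stem B.height s).count c := by
  rw [count_contacts, Bar.trunkCount]
  have : {l ∈ B.roots | B.ClimbsAt l c ∧ l ∈ rootSet F} =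
      ((s.filter fun a => HasLead (a - B.stem) B.height c).toFinset : Set (HahnSeries ℚ ℂ)) := by
    ext l
    simp only [Set.mem_ofPred_eq, Finset.mem_coe, Multiset.mem_toFinset, Multiset.mem_filter,
      Bar.climbsAt_iff, hF.mem_rootSet]
    exact ⟨fun h => ⟨h.2.2, h.2.1⟩, fun h => ⟨hB.mem_roots hΛ hne
      (hsub (hF.mem_rootSet.2 h.1)) h.2, h.2, h.1⟩⟩
  rw [this, Set.ncard_coe_finset, Multiset.toFinset_card_of_nodup (hs.filter _)]

end Invariants

/-! ### Comparison of the two leading coefficients of the Jacobian -/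

/-- The polynomial with the given roots and leading coefficient `κ`. -/
def leadPoly (κ : ℂ) (m : Multiset ℂ) : Polynomial ℂ :=
  Polynomial.C κ * (m.map fun c => Polynomial.X - Polynomial.C c).prod

lemma eval_leadPoly (κ : ℂ) (m : Multiset ℂ) (z : ℂ) :
    (leadPoly κ m).eval z = κ * (m.map fun c => z - c).prod := by
  rw [leadPoly, Polynomial.eval_mul, Polynomial.eval_C, Polynomial.eval_multiset_prod,
    Multiset.map_map]
  simp

lemma leadPoly_eval_ne_zero {κ : ℂ} (hκ : κ ≠ 0) {m : Multiset ℂ} {z : ℂ} (hz : z ∉ m) :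
    (leadPoly κ m).eval z ≠ 0 := by
  rw [eval_leadPoly]
  exact mul_ne_zero hκ (prod_sub_ne_zero hz)

lemma leadPoly_ne_zero {κ : ℂ} (hκ : κ ≠ 0) (m : Multiset ℂ) : leadPoly κ m ≠ 0 :=
  mul_ne_zero (Polynomial.C_ne_zero.2 hκ)
    (Polynomial.monic_multiset_prod_of_monic _ _ fun c _ => Polynomial.monic_X_sub_C c).ne_zero

open Classical in
lemma rootMultiplicity_leadPoly {κ : ℂ} (hκ : κ ≠ 0) (m : Multiset ℂ) (z : ℂ) :
    (leadPoly κ m).rootMultiplicity z = m.count z := by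
  rw [leadPoly, ← Polynomial.count_roots, Polynomial.roots_C_mul _ hκ,
    Polynomial.roots_multiset_prod_X_sub_C]

open Classical in
lemma sum_count_mul_inv {Z : Finset ℂ} {m : Multiset ℂ} (hm : ∀ c ∈ m, c ∈ Z) (z : ℂ) :
    (m.map fun c => (z - c)⁻¹).sum = ∑ c ∈ Z, (m.count c : ℂ) * (z - c)⁻¹ := by
  rw [Finset.sum_multiset_map_count]
  refine (Finset.sum_subset (fun c hc => hm c (Multiset.mem_toFinset.1 hc)) fun c _ hc => ?_).trans
    (Finset.sum_congr rfl fun c _ => nsmul_eq_mul _ _)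
  rw [Multiset.count_eq_zero_of_notMem fun h => hc (Multiset.mem_toFinset.2 h), zero_smul]

lemma rootSet_subset_mul_left (f g : MvPowerSeries (Fin 2) ℂ) : rootSet f ⊆ rootSet (f * g) :=
  fun _ h => ⟨h.1, by rw [evalAt_mul _ _ h.1.1, h.2, zero_mul]⟩

/-- Polar roots climbing over a bar of positive height at a pure mero-zero. -/
lemma polarRootsAt_of_height_pos {f g : MvPowerSeries (Fin 2) ℂ} (hf : f ≠ 0) (hg : g ≠ 0)
    (hsimple : ∀ l ∈ rootSet (f * g), rootMult (f * g) l = 1)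
    {B : Bar} (hB : IsBar (rootSet (f * g)) B) (hh : 0 < B.height)
    (hnc : B.IsNonCollinear f g) {z : ℂ} (hz : B.IsPureMeroZero f g z) :
    (polarRootsAt f g B z).Finite ∧
    ∑ᶠ γ ∈ polarRootsAt f g B z, rootMult (jac f g) γ = (B.meroMult f g z : ℕ∞) ∧
    ∀ γ ∈ polarRootsAt f g B z, B.LeavesAt γ z := by
  classical
  obtain ⟨Ef, Uf, sf, hFf⟩ := exists_isFactored hf
  obtain ⟨Eg, Ug, sg, hFg⟩ := exists_isFactored hg
  obtain ⟨Efg, Ufg, sfg, hFfg⟩ := exists_isFactored (mul_ne_zero hf hg)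
  have hΛ : ∀ l ∈ rootSet (f * g), 0 < l.orderTop := fun l hl => hl.1.1
  have hsubf : rootSet f ⊆ rootSet (f * g) := rootSet_subset_mul_left f g
  have hsubg : rootSet g ⊆ rootSet (f * g) := mul_comm f g ▸ rootSet_subset_mul_left g f
  have hne : B.roots.Nonempty := by
    obtain ⟨c, hc, -⟩ := hnc
    obtain ⟨l, hl, -⟩ := Bar.hasTrunkAt_iff.1 hc
    exact ⟨l, hl⟩
  have hl := hB.stem_pos hΛ hne
  obtain ⟨Z, hZ, hM⟩ := hB.exists_pf hFfg.finite_rootSet hΛ f g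
  obtain ⟨μ, κ, hκ, hleadf⟩ := hFf.exists_hasLead hl hh
  obtain ⟨ν, κ', hκ', hleadg⟩ := hFg.exists_hasLead hl hh
  set mf := contacts B.stem B.height sf with hmf
  set mg := contacts B.stem B.height sg with hmg
  have hmfZ : ∀ c ∈ mf, c ∈ Z := by
    intro c hc
    obtain ⟨a, ha, hac⟩ := mem_contacts.1 hc
    exact (hZ c).2 (Bar.hasTrunkAt_iff.2 ⟨a, hB.mem_roots hΛ hne
      (hsubf (hFf.mem_rootSet.2 ha)) hac, Bar.climbsAt_iff.2 hac⟩)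
  have hmgZ : ∀ c ∈ mg, c ∈ Z := by
    intro c hc
    obtain ⟨a, ha, hac⟩ := mem_contacts.1 hc
    exact (hZ c).2 (Bar.hasTrunkAt_iff.2 ⟨a, hB.mem_roots hΛ hne
      (hsubg (hFg.mem_rootSet.2 ha)) hac, Bar.climbsAt_iff.2 hac⟩)
  have hdelta : ∀ c, ((B.delta f g c : ℚ) : ℂ) = μ * mg.count c - ν * mf.count c := by
    intro c
    rw [Bar.delta, Bar.nu_eq hh hκ hleadf, Bar.nu_eq hh hκ' hleadg,
      hB.trunkCount_eq hΛ hne hFf (hFf.nodup hsimple) hsubf,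
      hB.trunkCount_eq hΛ hne hFg (hFg.nodup (mul_comm f g ▸ hsimple)) hsubg]
    push_cast
    rfl
  set d : ℂ → ℂ := fun c => ((B.delta f g c : ℚ) : ℂ) with hd
  obtain ⟨hz0, hzc⟩ := hz
  rw [Bar.IsMeroZero, hM] at hz0
  have hzZ : z ∉ Z := notMem_of_isRoot_num hz0 fun hmem =>
    Rat.cast_ne_zero.2 fun h0 => hzc ⟨(hZ z).1 hmem, h0⟩
  have hN : pfNum Z d ≠ 0 := by
    obtain ⟨c, hc, hdc⟩ := hnc
    intro h
    have := pfNum_eval_ne_zero (d := d) ((hZ c).2 hc) (Rat.cast_ne_zero.2 hdc)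
    rw [h] at this
    simp at this
  have hmult : B.meroMult f g z = (pfNum Z d).rootMultiplicity z := by
    rw [Bar.meroMult, hM, rootMultiplicity_num hz0 hzZ hN]
  have hleadJ : ∀ ξ w, HasLead (ξ - B.stem) B.height w → w ∉ Z →
      HasLead (evalAt (jac f g) ξ) (μ + ν - B.height - 1)
        ((leadPoly κ mf).eval w * (leadPoly κ' mg).eval w * ∑ c ∈ Z, d c * (w - c)⁻¹) := by
    intro ξ w hξ hw
    have hwf : w ∉ mf := fun h => hw (hmfZ w h)
    have hwg : w ∉ mg := fun h => hw (hmgZ w h)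
    have h1 := hasLead_jac hl hh hξ (hleadf ξ w hξ) (mul_ne_zero hκ (prod_sub_ne_zero hwf))
      (hleadg ξ w hξ) (mul_ne_zero hκ' (prod_sub_ne_zero hwg))
      (hFf.hasLead_logDeriv hl hh hξ hwf) (hFg.hasLead_logDeriv hl hh hξ hwg)
    rw [eval_leadPoly, eval_leadPoly]
    convert h1 using 2
    rw [sum_count_mul_inv hmfZ, sum_count_mul_inv hmgZ, Finset.mul_sum, Finset.mul_sum,
      ← Finset.sum_sub_distrib]
    refine Finset.sum_congr rfl fun c _ => ?_
    rw [hd]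
    simp only [hdelta]
    ring
  have hgen : ∀ w, w ∉ Z → (pfNum Z d).eval w ≠ 0 →
      (leadPoly κ mf).eval w * (leadPoly κ' mg).eval w * ∑ c ∈ Z, d c * (w - c)⁻¹ ≠ 0 := by
    intro w hw hNw
    rw [pfNum_eval_of_notMem hw] at hNw
    exact mul_ne_zero (mul_ne_zero (leadPoly_eval_ne_zero hκ fun h => hw (hmfZ w h))
      (leadPoly_eval_ne_zero hκ' fun h => hw (hmgZ w h))) (right_ne_zero_of_mul hNw)
  -- Generic points avoid the trunk points, the zeros of `M_B` and a further finite set `m`, taken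
  -- below to be empty or the contact points of `J`.
  have hfinite : ∀ m : Multiset ℂ,
      (((Z ∪ (pfNum Z d).roots.toFinset ∪ m.toFinset : Finset ℂ) : Set ℂ)ᶜ).Infinite := fun m =>
    (Finset.finite_toSet _).infinite_compl
  have hJ : jac f g ≠ 0 := by
    intro hJ
    obtain ⟨w, hw⟩ := (hfinite 0).nonempty
    simp only [Set.mem_compl_iff, Finset.mem_coe, Finset.mem_union, Multiset.mem_toFinset,
      Polynomial.mem_roots hN, not_or] at hw
    have h1 := (hleadJ _ w (hasLead_point B w) hw.1.1).ne_zero (hgen w hw.1.1 hw.1.2)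
    rw [hJ, ← evalAdd_apply, map_zero] at h1
    exact h1 rfl
  obtain ⟨EJ, UJ, sJ, hFJ⟩ := exists_isFactored hJ
  obtain ⟨ρ, κJ, hκJ, hleadJ'⟩ := hFJ.exists_hasLead hl hh
  set mJ := contacts B.stem B.height sJ with hmJ
  -- A nonzero leading coefficient is unique, so the product over the roots of `J` equals the one
  -- given by `M_B` at every generic `w`.
  have hpoly : leadPoly κJ mJ * pfDen Z = pfNum Z d * (leadPoly κ mf * leadPoly κ' mg) := by
    refine Polynomial.eq_of_infinite_eval_eq _ _ ((hfinite mJ).mono fun w hw => ?_)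
    simp only [Set.mem_compl_iff, Finset.mem_coe, Finset.mem_union, Multiset.mem_toFinset,
      Polynomial.mem_roots hN, not_or] at hw
    have h1 := hleadJ _ w (hasLead_point B w) hw.1.1
    have h2 := hleadJ' _ w (hasLead_point B w)
    have h3 := (h2.unique (mul_ne_zero hκJ (prod_sub_ne_zero hw.2)) h1
      (hgen w hw.1.1 hw.1.2)).2
    change Polynomial.eval w _ = Polynomial.eval w _
    rw [Polynomial.eval_mul, Polynomial.eval_mul, Polynomial.eval_mul, eval_leadPoly κJ, h3,
      pfNum_eval_of_notMem hw.1.1]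
    ring
  have hzf : z ∉ mf := fun h => hzZ (hmfZ z h)
  have hzg : z ∉ mg := fun h => hzZ (hmgZ z h)
  -- In `hpoly` neither `pfDen Z` nor the polynomials of `f` and `g` vanish at `z`, as `z` is not a
  -- trunk point.
  have hcount : mJ.count z = B.meroMult f g z := by
    rw [hmult, ← rootMultiplicity_leadPoly hκJ,
      ← rootMultiplicity_mul_of_eval_ne_zero (leadPoly_ne_zero hκJ mJ) (pfDen_eval_ne_zero hzZ),
      hpoly, rootMultiplicity_mul_of_eval_ne_zero hN]
    rw [Polynomial.eval_mul]
    exact mul_ne_zero (leadPoly_eval_ne_zero hκ hzf) (leadPoly_eval_ne_zero hκ' hzg)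
  -- Every root of `J` climbing at `z` is polar: the leading coefficients of `f` and `g` there are
  -- nonzero.
  have hset : polarRootsAt f g B z =
      ((sJ.filter fun a => HasLead (a - B.stem) B.height z).toFinset :
        Set (HahnSeries ℚ ℂ)) := by
    ext γ
    simp only [polarRootsAt, Set.mem_ofPred_eq, Finset.mem_coe, Multiset.mem_toFinset,
      Multiset.mem_filter, Bar.climbsAt_iff, IsPolarRoot]
    constructor
    · rintro ⟨⟨h1, h2, -⟩, h3⟩
      exact ⟨hFJ.mem_rootSet.1 ⟨h1, h2⟩, h3⟩
    · rintro ⟨h1, h3⟩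
      obtain ⟨h1, h2⟩ := hFJ.mem_rootSet.2 h1
      refine ⟨⟨h1, h2, mul_ne_zero ?_ ?_⟩, h3⟩
      · exact (hleadf γ z h3).ne_zero (mul_ne_zero hκ (prod_sub_ne_zero hzf))
      · exact (hleadg γ z h3).ne_zero (mul_ne_zero hκ' (prod_sub_ne_zero hzg))
  refine ⟨by rw [hset]; exact Finset.finite_toSet _, ?_, ?_⟩
  · rw [hset, finsum_mem_coe_finset, ← hcount, count_contacts, ← Multiset.toFinset_sum_count_eq,
      Nat.cast_sum]
    refine Finset.sum_congr rfl fun γ hγ => ?_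
    rw [Multiset.mem_toFinset, Multiset.mem_filter] at hγ
    rw [hFJ.rootMult_eq (hFJ.arc γ hγ.1).1, Multiset.count_filter_of_pos
      (p := fun a => HasLead (a - B.stem) B.height z) hγ.2]
  · intro γ hγ
    exact ⟨hγ.2, fun h => hzZ ((hZ z).2 h)⟩

/-- Along the zero arc the zero series vanishes together with its derivative, so simplicity of the
roots rules out `f * g = 0`. -/
lemma rootSet_zero_not_simple (h : ∀ l ∈ rootSet 0, rootMult 0 l = 1) : False := by
  have h0 : (0 : HahnSeries ℚ ℂ) ∈ rootSet 0 := by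
    refine ⟨⟨by simp, 1, one_pos, by simp⟩, ?_⟩
    rw [← evalAdd_apply, map_zero]
  refine evalAt_pderiv_ne_zero h0.2 (h 0 h0) ?_
  rw [map_zero]
  exact h0.2

end PolarTree

end

theorem mainTheorem8 (f g : MvPowerSeries (Fin 2) ℂ)
    (hf : PolarTree.IsConvergent f) (hg : PolarTree.IsConvergent g)
    (hf0 : MvPowerSeries.constantCoeff f = 0) (hg0 : MvPowerSeries.constantCoeff g = 0)
    (hsimple : ∀ l ∈ PolarTree.rootSet (f * g), PolarTree.rootMult (f * g) l = 1)
    (B : PolarTree.Bar) (hB : PolarTree.IsBar (PolarTree.rootSet (f * g)) B)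
    (hnc : B.IsNonCollinear f g) (z : ℂ) (hz : B.IsPureMeroZero f g z) :
    (PolarTree.polarRootsAt f g B z).Finite ∧
    ∑ᶠ γ ∈ PolarTree.polarRootsAt f g B z, PolarTree.rootMult (PolarTree.jac f g) γ =
      (B.meroMult f g z : ℕ∞) ∧
    ∀ γ ∈ PolarTree.polarRootsAt f g B z, B.LeavesAt γ z := by
  have hfg : f * g ≠ 0 := fun h => PolarTree.rootSet_zero_not_simple (h ▸ hsimple)
  have hΛ : ∀ l ∈ PolarTree.rootSet (f * g), 0 < l.orderTop := fun l hl => hl.1.1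
  rcases (hB.roots_spec hΛ).2.2.2 with h | h
  · subst h
    obtain ⟨E, U, s, hs⟩ := PolarTree.exists_isFactored hfg
    exact absurd hz (PolarTree.not_isPureMeroZero_ground hs.finite_rootSet hΛ hnc z)
  · exact PolarTree.polarRootsAt_of_height_pos (left_ne_zero_of_mul hfg)
      (right_ne_zero_of_mul hfg) hsimple hB h hnc hz
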